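/- Let $d\ge 2$ be even and let $m\in\mathbb R\setminus\{-d,-d+2,\ldots,d-2,d\}$. Write $\mathbb T^d$ for the product of $d$ unit circles in $\mathbb C$ and $\mathbb S^d$ for the unit sphere of $\mathbb R^{d+1}$. The map $g_{d,m}:\mathbb T^d\to\mathbb R^{d+1}$, $$g_{d,m}\big(e^{\imath\theta_1},\ldots,e^{\imath\theta_d}\big)=\Big(\sin\theta_1,\ldots,\sin\theta_d,\;m-\sum_{n=1}^d\cos\theta_n\Big),$$ has no zeros; let $f_{d,m}=\|g_{d,m}\|^{-1}g_{d,m}:\mathbb T^d\to\mathbb S^d$. Orient $\mathbb T^d$ by the atlas of charts $\varphi_{\mathbf j}$, $\mathbf j=(j_1,\ldots,j_d)\in\{0,1\}^d$, given by $$\varphi_{\mathbf j}\big(e^{\imath\theta_1},\ldots,e^{\imath\theta_d}\big)=\Big((-1)^{|\mathbf j|}\tfrac{\cos\theta_1}{1+(-1)^{j_1}\sin\theta_1},\tfrac{\cos\theta_2}{1+(-1)^{j_2}\sin\theta_2},\ldots,\tfrac{\cos\theta_d}{1+(-1)^{j_d}\sin\theta_d}\Big),\qquad |\mathbf j|=\sum_{n=1}^d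 j_n,$$ each on the open set where all its denominators are nonzero (this is the orientation $d\theta_1\wedge\cdots\wedge d\theta_d$). Orient $\mathbb S^d$ by the atlas consisting of the two charts $$\psi_1(x)=\tfrac{(x_1,x_2,x_3,\ldots,x_d)}{1-x_{d+1}}\ \ (x_{d+1}\ne1),\qquad \psi_2(x)=\tfrac{(x_2,x_1,x_3,\ldots,x_d)}{1+x_{d+1}}\ \ (x_{d+1}\ne-1).$$ The mapping degree $\deg(f)$ of a smooth map $f:\mathbb T^d\to\mathbb S^d$ is the integer which, for every regular value $p$ of $f$ (and regular values exist), equals the sum, over the finitely many points of $f^{-1}(p)$, of the signs of the Jacobian determinants of $f$ in charts of these two atlases. Then $f_{d,m}$ is smooth and, for every odd integer $n$ with $0<n<d+1$, $$\deg(f_{d,m})=\begin{cases}\displaystyle\sum_{k=0}^{(d-n-1)/2}(-1)^k\binom dk, & m\in(n-1,n+1),\\[2mm] \displaystyle\sum_{k=0}^{(d-n-1)/2}(-1)^{k+1}\binom dk, & m\in(-n-1,-n+1),\end{cases}$$ while $\deg(f_{d,m})=0$ if $|m|>d$. In particular $\deg(f_{d,d-1})=1$. -/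

import Mathlib

open scoped ContDiff

namespace TorusSphere

/-- The torus `𝕋^d`, a product of `d` unit circles in `ℂ`. -/
abbrev Torus (d : ℕ) : Type := Fin d → Circle

/-- The unit sphere `𝕊^d` in Euclidean `ℝ^(d+1)`. -/
abbrev Sphere (d : ℕ) : Type := Metric.sphere (0 : EuclideanSpace ℝ (Fin (d + 1))) 1

/-- The angular parametrization `θ ↦ (e^{iθ_1}, …, e^{iθ_d})`. -/
noncomputable def expTorus {d : ℕ} (θ : Fin d → ℝ) : Torus d := fun n => Circle.exp (θ n)

/-! ### The maps `g_{d,m}` and `f_{d,m}` -/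

/-- `g_{d,m}(e^{iθ_1}, …, e^{iθ_d}) = (sin θ_1, …, sin θ_d, m - ∑ cos θ_n)`, where
`sin θ_n` and `cos θ_n` are the imaginary and the real part of `e^{iθ_n}`; see `gMap_expTorus`. -/
noncomputable def gMap (d : ℕ) (m : ℝ) (z : Torus d) : EuclideanSpace ℝ (Fin (d + 1)) :=
  WithLp.toLp 2 (Fin.snoc (α := fun _ => ℝ) (fun n : Fin d => (z n : ℂ).im)
    (m - ∑ n, (z n : ℂ).re))

theorem gMap_expTorus (d : ℕ) (m : ℝ) (θ : Fin d → ℝ) :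
    gMap d m (expTorus θ) = WithLp.toLp 2 (Fin.snoc (α := fun _ => ℝ)
      (fun n : Fin d => Real.sin (θ n)) (m - ∑ n, Real.cos (θ n))) := by
  simp [gMap, expTorus, Circle.coe_exp, Complex.exp_ofReal_mul_I_re, Complex.exp_ofReal_mul_I_im]

/-- `g_{d,m}` has no zero when `m ∉ {-d, -d+2, …, d-2, d}`. -/
theorem gMap_ne_zero {d : ℕ} {m : ℝ} (hm : ∀ k : ℕ, k ≤ d → m ≠ (d : ℝ) - 2 * k) (z : Torus d) :
    gMap d m z ≠ 0 := by
  intro h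
  have him : ∀ n : Fin d, (z n : ℂ).im = 0 := by
    intro n
    have := congrArg (fun v : EuclideanSpace ℝ (Fin (d + 1)) => v n.castSucc) h
    simpa [gMap] using this
  have hsum : m = ∑ n, (z n : ℂ).re := by
    have := congrArg (fun v : EuclideanSpace ℝ (Fin (d + 1)) => v (Fin.last d)) h
    have h2 : m - ∑ n, (z n : ℂ).re = 0 := by simpa [gMap] using this
    linarith
  have hre : ∀ n : Fin d, (z n : ℂ).re = 1 - 2 * (if (z n : ℂ).re = -1 then (1 : ℝ) else 0) := by
    intro n
    have h1 : Complex.normSq (z n : ℂ) = 1 := Circle.normSq_coe (z n)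
    rw [Complex.normSq_apply, him n] at h1
    have h2 : ((z n : ℂ).re - 1) * ((z n : ℂ).re + 1) = 0 := by linarith
    rcases mul_eq_zero.1 h2 with h3 | h3
    · have h4 : (z n : ℂ).re = 1 := by linarith
      rw [h4]; norm_num
    · have h4 : (z n : ℂ).re = -1 := by linarith
      rw [h4]; norm_num
  refine hm (Finset.univ.filter fun n : Fin d => (z n : ℂ).re = -1).card ?_ ?_
  · simpa using Finset.card_le_univ (Finset.univ.filter fun n : Fin d => (z n : ℂ).re = -1)
  · rw [hsum, Finset.sum_congr rfl fun n _ => hre n]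
    rw [Finset.sum_sub_distrib, ← Finset.mul_sum, Finset.sum_boole]
    simp

/-- `f_{d,m} = ‖g_{d,m}‖⁻¹ g_{d,m} : 𝕋^d → 𝕊^d`, for `m ∉ {-d, -d+2, …, d-2, d}`. -/
noncomputable def fMap (d : ℕ) (m : ℝ) (hm : ∀ k : ℕ, k ≤ d → m ≠ (d : ℝ) - 2 * k)
    (z : Torus d) : Sphere d :=
  ⟨‖gMap d m z‖⁻¹ • gMap d m z, by
    have h : ‖gMap d m z‖ ≠ 0 := norm_ne_zero_iff.2 (gMap_ne_zero hm z)
    rw [mem_sphere_zero_iff_norm, norm_smul, norm_inv, norm_norm, inv_mul_cancel₀ h]⟩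

/-! ### The oriented atlas of the torus -/

/-- The sign `(-1)^{|j|}` in the first coordinate, and `1` in all others. -/
def chartSign {d : ℕ} (j : Fin d → Fin 2) (k : Fin d) : ℝ :=
  if (k : ℕ) = 0 then (-1) ^ (∑ n, (j n : ℕ)) else 1

/-- The domain `U_j` of the chart `φ_j`: the points where no denominator
`1 + (-1)^{j_n} sin θ_n` vanishes. -/
def torusDomain {d : ℕ} (j : Fin d → Fin 2) : Set (Torus d) :=
  {z | ∀ n, 1 + (-1) ^ (j n : ℕ) * (z n : ℂ).im ≠ 0}

/-- The chart `φ_j` of the torus, with coordinates `cos θ_n / (1 + (-1)^{j_n} sin θ_n)`, the first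
one multiplied by `(-1)^{|j|}`. -/
noncomputable def torusChart {d : ℕ} (j : Fin d → Fin 2) (z : Torus d) : Fin d → ℝ :=
  fun n => chartSign j n * ((z n : ℂ).re / (1 + (-1) ^ (j n : ℕ) * (z n : ℂ).im))

/-- The point `(2v + i (-1)^a (1 - v²)) / (1 + v²)` of the unit circle. -/
noncomputable def circlePoint (a : ℕ) (v : ℝ) : Circle :=
  ⟨⟨2 * v / (1 + v ^ 2), (-1) ^ a * ((1 - v ^ 2) / (1 + v ^ 2))⟩, by
    have h : (1 : ℝ) + v ^ 2 ≠ 0 := by positivity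
    have h2 : (((-1 : ℝ)) ^ a) * (-1) ^ a = 1 := by
      rw [← mul_pow]; norm_num
    rw [Submonoid.unitSphere, ← SetLike.mem_coe, Submonoid.coe_set_mk, Subsemigroup.coe_set_mk,
      mem_sphere_zero_iff_norm, ← sq_eq_sq₀ (norm_nonneg _) zero_le_one,
      ← Complex.normSq_eq_norm_sq,
      Complex.normSq_mk]
    have h3 : (-1 : ℝ) ^ a * ((1 - v ^ 2) / (1 + v ^ 2)) * ((-1) ^ a * ((1 - v ^ 2) / (1 + v ^ 2)))
        = ((1 - v ^ 2) / (1 + v ^ 2)) ^ 2 := by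
      linear_combination ((1 - v ^ 2) / (1 + v ^ 2)) ^ 2 * h2
    rw [h3]
    field_simp
    ring⟩

/-- The inverse `φ_j⁻¹ : ℝ^d → U_j` of the chart `φ_j`; see the three lemmas below. -/
noncomputable def torusChartInv {d : ℕ} (j : Fin d → Fin 2) (u : Fin d → ℝ) : Torus d :=
  fun n => circlePoint (j n) (chartSign j n * u n)

theorem chartSign_mul_self {d : ℕ} (j : Fin d → Fin 2) (k : Fin d) :
    chartSign j k * chartSign j k = 1 := by
  unfold chartSign
  split_ifs
  · rw [← mul_pow]; norm_num
  · norm_num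

theorem torusChartInv_mem {d : ℕ} (j : Fin d → Fin 2) (u : Fin d → ℝ) :
    torusChartInv j u ∈ torusDomain j := by
  intro n
  have h2 : (((-1 : ℝ)) ^ (j n : ℕ)) * (-1) ^ (j n : ℕ) = 1 := by
    rw [← mul_pow]; norm_num
  have h : (1 : ℝ) + (chartSign j n * u n) ^ 2 ≠ 0 := by positivity
  change 1 + (-1) ^ (j n : ℕ) * ((-1) ^ (j n : ℕ) *
    ((1 - (chartSign j n * u n) ^ 2) / (1 + (chartSign j n * u n) ^ 2))) ≠ 0
  rw [← mul_assoc, h2]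
  have h3 : 1 + 1 * ((1 - (chartSign j n * u n) ^ 2) / (1 + (chartSign j n * u n) ^ 2)) =
      2 / (1 + (chartSign j n * u n) ^ 2) := by
    field_simp; ring
  rw [h3]
  positivity

theorem torusChart_torusChartInv {d : ℕ} (j : Fin d → Fin 2) (u : Fin d → ℝ) :
    torusChart j (torusChartInv j u) = u := by
  funext n
  have h2 : (((-1 : ℝ)) ^ (j n : ℕ)) * (-1) ^ (j n : ℕ) = 1 := by
    rw [← mul_pow]; norm_num
  have hs := chartSign_mul_self j n
  change chartSign j n * (2 * (chartSign j n * u n) / (1 + (chartSign j n * u n) ^ 2) /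
    (1 + (-1) ^ (j n : ℕ) * ((-1) ^ (j n : ℕ) *
    ((1 - (chartSign j n * u n) ^ 2) / (1 + (chartSign j n * u n) ^ 2))))) = u n
  rw [← mul_assoc ((-1) ^ (j n : ℕ)), h2]
  generalize hv : chartSign j n * u n = v
  have h : (1 : ℝ) + v ^ 2 ≠ 0 := by positivity
  have h3 : 1 + 1 * ((1 - v ^ 2) / (1 + v ^ 2)) = 2 / (1 + v ^ 2) := by
    field_simp; ring
  rw [h3]
  have h4 : 2 * v / (1 + v ^ 2) / (2 / (1 + v ^ 2)) = v := by field_simp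
  rw [h4, ← hv, ← mul_assoc, hs, one_mul]

theorem torusChartInv_torusChart {d : ℕ} (j : Fin d → Fin 2) {z : Torus d}
    (hz : z ∈ torusDomain j) : torusChartInv j (torusChart j z) = z := by
  funext n
  have hn := hz n
  have hs := chartSign_mul_self j n
  have h1 : Complex.normSq (z n : ℂ) = 1 := Circle.normSq_coe (z n)
  rw [Complex.normSq_apply] at h1
  have h2 : (((-1 : ℝ)) ^ (j n : ℕ)) * (-1) ^ (j n : ℕ) = 1 := by
    rw [← mul_pow]; norm_num
  have hv : chartSign j n * torusChart j z n =
      (z n : ℂ).re / (1 + (-1) ^ (j n : ℕ) * (z n : ℂ).im) := by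
    rw [torusChart, ← mul_assoc, hs, one_mul]
  unfold torusChartInv
  rw [hv]
  generalize hee : (-1 : ℝ) ^ (j n : ℕ) = e at *
  have key : (1 + e * (z n : ℂ).im) ^ 2 + (z n : ℂ).re ^ 2 = 2 * (1 + e * (z n : ℂ).im) := by
    linear_combination h1 + (z n : ℂ).im ^ 2 * h2
  have h5 : 1 + ((z n : ℂ).re / (1 + e * (z n : ℂ).im)) ^ 2 = 2 / (1 + e * (z n : ℂ).im) := by
    rw [div_pow, eq_div_iff hn]
    field_simp
    linear_combination key
  apply Circle.ext
  apply Complex.ext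
  · change 2 * ((z n : ℂ).re / _) / _ = _
    rw [h5]
    field_simp
  · change (-1 : ℝ) ^ (j n : ℕ) * ((1 - ((z n : ℂ).re / _) ^ 2) / _) = _
    have h6 : 1 - ((z n : ℂ).re / (1 + e * (z n : ℂ).im)) ^ 2 =
        2 * (e * (z n : ℂ).im) / (1 + e * (z n : ℂ).im) := by
      have h7 : 2 * (e * (z n : ℂ).im) / (1 + e * (z n : ℂ).im) =
          2 - 2 / (1 + e * (z n : ℂ).im) := by
        field_simp; ring
      rw [h7, ← h5]; ring
    rw [h5, h6, hee]
    field_simp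
    linear_combination (z n : ℂ).im * h2

/-! ### The oriented atlas of the sphere -/

/-- The domains `V_1 = {x_{d+1} ≠ 1}` (index `0`) and `V_2 = {x_{d+1} ≠ -1}` (index `1`). -/
def sphereDomain {d : ℕ} (i : Fin 2) : Set (Sphere d) :=
  {x | (x : EuclideanSpace ℝ (Fin (d + 1))) (Fin.last d) ≠ if i = 0 then 1 else -1}

/-- The stereographic charts of the sphere: `ψ_1(x) = (x_1, x_2, x_3, …, x_d) / (1 - x_{d+1})`
(index `0`) and `ψ_2(x) = (x_2, x_1, x_3, …, x_d) / (1 + x_{d+1})` (index `1`). They are used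
for `2 ≤ d` only. -/
noncomputable def sphereChart {d : ℕ} (i : Fin 2) (x : Sphere d) : Fin d → ℝ :=
  fun k =>
    if i = 0 then
      (x : EuclideanSpace ℝ (Fin (d + 1))) k.castSucc /
        (1 - (x : EuclideanSpace ℝ (Fin (d + 1))) (Fin.last d))
    else
      (x : EuclideanSpace ℝ (Fin (d + 1))) (Equiv.swap 0 1 k.castSucc) /
        (1 + (x : EuclideanSpace ℝ (Fin (d + 1))) (Fin.last d))

/-! ### The mapping degree -/

/-- The map `ψ_i ∘ f ∘ φ_j⁻¹` that represents `f` in the charts `φ_j` and `ψ_i`. -/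
noncomputable def chartRep {d : ℕ} (f : Torus d → Sphere d) (j : Fin d → Fin 2) (i : Fin 2) :
    (Fin d → ℝ) → (Fin d → ℝ) :=
  fun u => sphereChart i (f (torusChartInv j u))

/-- Smoothness of `f : 𝕋^d → 𝕊^d`: it is continuous and smooth in all charts. -/
def IsSmoothMap {d : ℕ} (f : Torus d → Sphere d) : Prop :=
  Continuous f ∧ ∀ (j : Fin d → Fin 2) (i : Fin 2),
    ContDiffOn ℝ ∞ (chartRep f j i) {u | f (torusChartInv j u) ∈ sphereDomain i}

/-- The Jacobian determinant at `z` of `f` in the charts `φ_j` and `ψ_i`. -/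
noncomputable def jacobianDet {d : ℕ} (f : Torus d → Sphere d) (j : Fin d → Fin 2) (i : Fin 2)
    (z : Torus d) : ℝ :=
  (fderiv ℝ (chartRep f j i) (torusChart j z)).det

/-- `p` is a regular value of `f`: at each preimage of `p` the Jacobian determinants in the charts
around this preimage and around `p` do not vanish. -/
def IsRegularValue {d : ℕ} (f : Torus d → Sphere d) (p : Sphere d) : Prop :=
  ∀ z, f z = p → ∀ (j : Fin d → Fin 2) (i : Fin 2), z ∈ torusDomain j → p ∈ sphereDomain i →
    jacobianDet f j i z ≠ 0

/-- `s z` is, for every preimage `z` of `p`, the sign of the Jacobian determinant of `f` at `z`,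
in whichever charts of the two oriented atlases it is computed. -/
def IsSignAt {d : ℕ} (f : Torus d → Sphere d) (p : Sphere d) (s : Torus d → ℤ) : Prop :=
  ∀ z, f z = p → ∀ (j : Fin d → Fin 2) (i : Fin 2), z ∈ torusDomain j → p ∈ sphereDomain i →
    s z = SignType.sign (jacobianDet f j i z)

/-- The smooth map `f : 𝕋^d → 𝕊^d` has mapping degree `N`: regular values exist, and each
regular value `p` has finitely many preimages, whose orientation signs sum up to `N`. -/
structure HasMappingDegree {d : ℕ} (f : Torus d → Sphere d) (N : ℤ) : Prop where
  smooth : IsSmoothMap f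
  exists_regularValue : ∃ p, IsRegularValue f p
  degree_eq : ∀ p, IsRegularValue f p → ∃ hfin : (f ⁻¹' {p}).Finite, ∃ s : Torus d → ℤ,
    IsSignAt f p s ∧ ∑ z ∈ hfin.toFinset, s z = N

theorem exists_mem_torusDomain {d : ℕ} (z : Torus d) :
    ∃ j : Fin d → Fin 2, z ∈ torusDomain j := by
  refine ⟨fun n => if 0 ≤ (z n : ℂ).im then 0 else 1, fun n => ?_⟩
  by_cases h : 0 ≤ (z n : ℂ).im
  · simp only [h, if_true, Fin.val_zero, pow_zero, one_mul]
    linarith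
  · simp only [h, if_false, Fin.val_one, pow_one]
    linarith [not_le.1 h]

theorem exists_mem_sphereDomain {d : ℕ} (p : Sphere d) : ∃ i : Fin 2, p ∈ sphereDomain i := by
  by_cases h : (p : EuclideanSpace ℝ (Fin (d + 1))) (Fin.last d) = 1
  · refine ⟨1, ?_⟩
    simp only [sphereDomain, Set.mem_ofPred_eq, h]
    norm_num
  · exact ⟨0, by simpa [sphereDomain] using h⟩

/-- A map has at most one mapping degree. -/
theorem HasMappingDegree.unique {d : ℕ} {f : Torus d → Sphere d} {N M : ℤ}
    (hN : HasMappingDegree f N) (hM : HasMappingDegree f M) : N = M := by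
  obtain ⟨p, hp⟩ := hN.exists_regularValue
  obtain ⟨hfin, s, hs, rfl⟩ := hN.degree_eq p hp
  obtain ⟨_, t, ht, rfl⟩ := hM.degree_eq p hp
  refine Finset.sum_congr rfl fun z hz => ?_
  have hz : f z = p := by simpa using hz
  obtain ⟨j, hj⟩ := exists_mem_torusDomain z
  obtain ⟨i, hi⟩ := exists_mem_sphereDomain p
  rw [hs z hz j i hj hi, ht z hz j i hj hi]

end TorusSphere

namespace TorusSphere

/-! In angular coordinates, minus the determinant of `∂₁g, …, ∂_d g, g` is `∑ sin²θ_n ∏_{k≠n} cos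
θ_k - (m - ∑ cos θ_n) ∏ cos θ_n`, which is `jacobianDensity`. Every Jacobian determinant of `fMap`
in the oriented charts is a positive multiple of it (`exists_jacobianDet_eq`), so the degree is a
signed count of preimages weighted by its sign. A preimage of `p` is a point where `g` lies on the
open ray through `p`. If some `p_n` with `n ≤ d` is nonzero, take `l` with `|p_l|` maximal and `c =
cos θ_l`. The sines are then determined by `c`, and so are the other cosines up to signs `ε`. For
each `ε` the last coordinate gives one equation `branchFun = 0` on `(-1, 1)`, whose derivative at a
zero has the sign of the density up to the factor `-∏ ε_i`. A function with simple zeros has signed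
zero count `(sgn h(1) - sgn h(-1)) / 2`, and at `c = ±1` all dependence on `p` disappears. Summing
over `ε` gives `-signSum d m / 2` (`sum_sign_jacobianDensity_of_coord_ne_zero`). At the poles the
preimages are the points with all cosines `±1`, and the count is the same
(`sum_sign_jacobianDensity_of_pole`). Finally, grouping `signSum` by the number of negative signs
gives the truncated alternating binomial sum. -/

/-- The determinant of a rank one perturbation of a diagonal matrix. -/
theorem det_diagonal_add_vecMulVec {ι : Type*} [Fintype ι] [DecidableEq ι] (a u v : ι → ℝ) :
    (Matrix.diagonal a + Matrix.vecMulVec u v).det =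
      ∏ n, a n + ∑ n, u n * v n * ∏ k ∈ Finset.univ.erase n, a k := by
  have key : ∀ a : ι → ℝ, (∀ n, a n ≠ 0) → (Matrix.diagonal a + Matrix.vecMulVec u v).det =
      ∏ n, a n + ∑ n, u n * v n * ∏ k ∈ Finset.univ.erase n, a k := by
    intro a ha
    have h1 : Matrix.diagonal a + Matrix.vecMulVec u v = Matrix.diagonal a *
        (1 + Matrix.replicateCol Unit (fun n => u n / a n) * Matrix.replicateRow Unit v) := by
      ext i j
      have := ha i
      rw [Matrix.diagonal_mul]
      by_cases hij : i = j
      · subst hij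
        simp [Matrix.vecMulVec_apply, Matrix.mul_apply]
        field_simp
      · simp [Matrix.vecMulVec_apply, Matrix.mul_apply, hij]
        field_simp
    rw [h1, Matrix.det_mul, Matrix.det_diagonal, Matrix.det_one_add_replicateCol_mul_replicateRow,
      mul_add, mul_one, dotProduct, Finset.mul_sum]
    congr 1
    refine Finset.sum_congr rfl fun n _ => ?_
    have := ha n
    rw [← Finset.mul_prod_erase _ _ (Finset.mem_univ n)]
    field_simp
  -- Shifting all diagonal entries by `t` makes them nonzero for all but finitely many `t`;
  -- continuity then carries the formula to `t = 0`.
  have hd : Dense ((Set.range fun n => -a n)ᶜ : Set ℝ) := Set.Countable.dense_compl ℝ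
    (Set.finite_range _).countable
  have h : (fun t : ℝ => (Matrix.diagonal (fun n => a n + t) + Matrix.vecMulVec u v).det) =
      fun t => ∏ n, (a n + t) + ∑ n, u n * v n * ∏ k ∈ Finset.univ.erase n, (a k + t) := by
    refine Continuous.ext_on hd ?_ (by fun_prop) fun t ht => key _ fun n hn => ht ⟨n, ?_⟩
    · refine Continuous.matrix_det (Continuous.add (Continuous.matrix_diagonal ?_) continuous_const)
      fun_prop
    · change -a n = t
      linarith
  simpa using congrFun h 0

/-! ### The map in coordinates and its Jacobian density -/

/-- The last coordinate of `gMap d m z`. -/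
noncomputable def lastCoord {d : ℕ} (m : ℝ) (z : Torus d) : ℝ := m - ∑ n, (z n : ℂ).re

/-- The common factor of all Jacobian determinants of `fMap d m` at `z`, with respect to
oriented charts. -/
noncomputable def jacobianDensity {d : ℕ} (m : ℝ) (z : Torus d) : ℝ :=
  ∑ n, (z n : ℂ).im ^ 2 * ∏ k ∈ Finset.univ.erase n, (z k : ℂ).re -
    lastCoord m z * ∏ n, (z n : ℂ).re

theorem gMap_castSucc {d : ℕ} (m : ℝ) (z : Torus d) (n : Fin d) :
    gMap d m z n.castSucc = (z n : ℂ).im := by simp [gMap]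

theorem gMap_last {d : ℕ} (m : ℝ) (z : Torus d) : gMap d m z (Fin.last d) = lastCoord m z := by
  simp [gMap, lastCoord]

theorem norm_gMap {d : ℕ} (m : ℝ) (z : Torus d) :
    ‖gMap d m z‖ = √(∑ n, (z n : ℂ).im ^ 2 + lastCoord m z ^ 2) := by
  simp [EuclideanSpace.norm_eq, Fin.sum_univ_castSucc, gMap_castSucc, gMap_last]

theorem fMap_apply {d : ℕ} {m : ℝ} (hm : ∀ k : ℕ, k ≤ d → m ≠ (d : ℝ) - 2 * k) (z : Torus d)
    (k : Fin (d + 1)) : (fMap d m hm z : EuclideanSpace ℝ (Fin (d + 1))) k =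
      ‖gMap d m z‖⁻¹ * gMap d m z k := by simp [fMap]

/-- The sign of the pole from which the chart `sphereChart i` projects. -/
def poleSign (i : Fin 2) : ℝ := if i = 0 then 1 else -1

/-- The permutation of the coordinates in the chart `sphereChart i`. -/
def coordPerm {d : ℕ} [NeZero d] (i : Fin 2) : Equiv.Perm (Fin d) :=
  if i = 0 then 1 else Equiv.swap 0 1

theorem sphereChart_fMap {d : ℕ} [NeZero d] (hd : 2 ≤ d) {m : ℝ}
    (hm : ∀ k : ℕ, k ≤ d → m ≠ (d : ℝ) - 2 * k) (i : Fin 2) (z : Torus d) (k : Fin d) :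
    sphereChart i (fMap d m hm z) k =
      (z (coordPerm i k) : ℂ).im / (‖gMap d m z‖ - poleSign i * lastCoord m z) := by
  have hR : ‖gMap d m z‖ ≠ 0 := norm_ne_zero_iff.2 (gMap_ne_zero hm z)
  obtain ⟨e, rfl⟩ : ∃ e, d = e + 2 := ⟨d - 2, by omega⟩
  fin_cases i
  · simp only [sphereChart, fMap_apply, gMap_castSucc, gMap_last, poleSign, coordPerm]
    simp
    field_simp
  -- As `d ≥ 2`, the last coordinate is not one of the two that are swapped.
  · have h : (Equiv.swap 0 1 : Equiv.Perm (Fin (e + 2 + 1))) k.castSucc =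
        ((Equiv.swap 0 1 : Equiv.Perm (Fin (e + 2))) k).castSucc := by
      rcases eq_or_ne k 0 with rfl | h0
      · simp
      rcases eq_or_ne k 1 with rfl | h1
      · rw [Equiv.swap_apply_right, show (1 : Fin (e + 2)).castSucc = 1 from rfl,
          Equiv.swap_apply_right]
        rfl
      · rw [Equiv.swap_apply_of_ne_of_ne h0 h1, Equiv.swap_apply_of_ne_of_ne]
        · simpa using h0
        · intro h
          exact h1 (Fin.castSucc_injective _ h)
    simp only [sphereChart, fMap_apply, h, gMap_castSucc, gMap_last, poleSign, coordPerm]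
    simp
    field_simp

theorem fMap_mem_sphereDomain {d : ℕ} {m : ℝ}
    (hm : ∀ k : ℕ, k ≤ d → m ≠ (d : ℝ) - 2 * k) (i : Fin 2) (z : Torus d) :
    fMap d m hm z ∈ sphereDomain i ↔ ‖gMap d m z‖ - poleSign i * lastCoord m z ≠ 0 := by
  have hR : ‖gMap d m z‖ ≠ 0 := norm_ne_zero_iff.2 (gMap_ne_zero hm z)
  have h : ∀ s : ℝ, s * s = 1 → (‖gMap d m z‖⁻¹ * lastCoord m z ≠ s ↔
      ‖gMap d m z‖ - s * lastCoord m z ≠ 0) := by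
    intro s hs
    rw [not_iff_not, inv_mul_eq_iff_eq_mul₀ hR]
    constructor <;> intro h
    · linear_combination (-s) * h - ‖gMap d m z‖ * hs
    · linear_combination (-s) * h - lastCoord m z * hs
  change (fMap d m hm z : EuclideanSpace ℝ (Fin (d + 1))) (Fin.last d) ≠ poleSign i ↔ _
  rw [fMap_apply, gMap_last]
  exact h _ (by unfold poleSign; split_ifs <;> norm_num)

/-! ### Derivatives and Jacobian determinants in the charts -/

theorem one_add_sq_ne_zero (t : ℝ) : (1 : ℝ) + t ^ 2 ≠ 0 := by positivity

/-- The angular speed of the `n`-th circle coordinate in the chart `torusChart j`. -/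
noncomputable def chartRate {d : ℕ} (j : Fin d → Fin 2) (u : Fin d → ℝ) (n : Fin d) : ℝ :=
  -1 * ((-1) ^ (j n : ℕ) * chartSign j n * (2 / (1 + u n ^ 2)))

/-- The sign `(-1)^{|j|}` in the first chart coordinate cancels the product of the `(-1)^{j_n}`, and
the remaining `(-1)^d` is `1` because `d` is even. -/
theorem prod_chartRate_pos {d : ℕ} (hd : Even d) (hd0 : 0 < d) (j : Fin d → Fin 2)
    (u : Fin d → ℝ) : 0 < ∏ n, chartRate j u n := by
  have h1 : ∏ n, chartSign j n = (-1) ^ (∑ n, (j n : ℕ)) := by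
    rw [Finset.prod_eq_single (⟨0, hd0⟩ : Fin d)]
    · simp [chartSign]
    · intro b _ hb
      have : (b : ℕ) ≠ 0 := fun h => hb (Fin.ext h)
      simp [chartSign, this]
    · simp
  simp only [chartRate]
  rw [Finset.prod_mul_distrib, Finset.prod_mul_distrib, Finset.prod_mul_distrib, h1,
    Finset.prod_pow_eq_pow_sum, ← pow_add, ← two_mul, pow_mul, Finset.prod_const,
    Finset.card_univ, Fintype.card_fin, hd.neg_one_pow]
  simp only [even_two, Even.neg_pow, one_pow, one_mul]
  exact Finset.prod_pos fun n _ => by positivity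

theorem torusChartInv_re {d : ℕ} (j : Fin d → Fin 2) (u : Fin d → ℝ) (n : Fin d) :
    (torusChartInv j u n : ℂ).re = chartSign j n * (2 * u n / (1 + u n ^ 2)) := by
  change 2 * (chartSign j n * u n) / (1 + (chartSign j n * u n) ^ 2) = _
  rw [mul_pow, sq (chartSign j n), chartSign_mul_self, one_mul]
  ring

theorem torusChartInv_im {d : ℕ} (j : Fin d → Fin 2) (u : Fin d → ℝ) (n : Fin d) :
    (torusChartInv j u n : ℂ).im = (-1) ^ (j n : ℕ) * ((1 - u n ^ 2) / (1 + u n ^ 2)) := by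
  change (-1) ^ (j n : ℕ) * ((1 - (chartSign j n * u n) ^ 2) / (1 + (chartSign j n * u n) ^ 2)) = _
  rw [mul_pow, sq (chartSign j n), chartSign_mul_self, one_mul]

theorem hasFDerivAt_torusChartInv_re {d : ℕ} (j : Fin d → Fin 2) (u : Fin d → ℝ) (n : Fin d) :
    HasFDerivAt (fun u => (torusChartInv j u n : ℂ).re)
      ((-(chartRate j u n * (torusChartInv j u n : ℂ).im)) •
        (ContinuousLinearMap.proj n : (Fin d → ℝ) →L[ℝ] ℝ)) u := by
  simp only [torusChartInv_re, torusChartInv_im]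
  have h2 : ((-1 : ℝ)) ^ (j n : ℕ) * (-1) ^ (j n : ℕ) = 1 := by
    rw [← mul_pow]; norm_num
  have h := one_add_sq_ne_zero (u n)
  have h1 : HasDerivAt (fun t : ℝ => chartSign j n * (2 * t / (1 + t ^ 2)))
      (-(chartRate j u n * ((-1) ^ (j n : ℕ) * ((1 - u n ^ 2) / (1 + u n ^ 2))))) (u n) := by
    have := ((((hasDerivAt_id (u n)).const_mul 2).div
      (((hasDerivAt_id (u n)).pow 2).const_add 1) h).const_mul (chartSign j n))
    refine this.congr_deriv ?_
    simp only [chartRate, Pi.pow_apply, id]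
    field_simp
    linear_combination (-1) * chartSign j n * (1 - u n ^ 2) * h2
  exact HasDerivAt.comp_hasFDerivAt (f := fun u : Fin d → ℝ => u n) u h1 (hasFDerivAt_apply n u)

theorem hasFDerivAt_torusChartInv_im {d : ℕ} (j : Fin d → Fin 2) (u : Fin d → ℝ) (n : Fin d) :
    HasFDerivAt (fun u => (torusChartInv j u n : ℂ).im)
      ((chartRate j u n * (torusChartInv j u n : ℂ).re) •
        (ContinuousLinearMap.proj n : (Fin d → ℝ) →L[ℝ] ℝ)) u := by
  simp only [torusChartInv_re, torusChartInv_im]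
  have h2 := chartSign_mul_self j n
  have h := one_add_sq_ne_zero (u n)
  have h1 : HasDerivAt (fun t : ℝ => (-1) ^ (j n : ℕ) * ((1 - t ^ 2) / (1 + t ^ 2)))
      (chartRate j u n * (chartSign j n * (2 * u n / (1 + u n ^ 2)))) (u n) := by
    have := (((((hasDerivAt_id (u n)).pow 2).const_sub 1).div
      (((hasDerivAt_id (u n)).pow 2).const_add 1) h).const_mul ((-1 : ℝ) ^ (j n : ℕ)))
    refine this.congr_deriv ?_
    simp only [chartRate, Pi.pow_apply, id]
    field_simp
    simp
    linear_combination (4) * u n * h2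
  exact HasDerivAt.comp_hasFDerivAt (f := fun u : Fin d → ℝ => u n) u h1 (hasFDerivAt_apply n u)

theorem hasFDerivAt_lastCoord {d : ℕ} (m : ℝ) (j : Fin d → Fin 2) (u : Fin d → ℝ) :
    HasFDerivAt (fun u => lastCoord m (torusChartInv j u))
      (∑ n, (chartRate j u n * (torusChartInv j u n : ℂ).im) •
        (ContinuousLinearMap.proj n : (Fin d → ℝ) →L[ℝ] ℝ)) u := by
  have := (HasFDerivAt.fun_sum (u := Finset.univ)
    fun n _ => hasFDerivAt_torusChartInv_re j u n).const_sub m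
  refine this.congr_fderiv ?_
  ext v
  simp [Finset.sum_neg_distrib]

theorem hasFDerivAt_norm_gMap {d : ℕ} {m : ℝ} (j : Fin d → Fin 2) (u : Fin d → ℝ)
    (hR : ‖gMap d m (torusChartInv j u)‖ ≠ 0) :
    HasFDerivAt (fun u => ‖gMap d m (torusChartInv j u)‖)
      (∑ n, (chartRate j u n * (torusChartInv j u n : ℂ).im *
        ((torusChartInv j u n : ℂ).re + lastCoord m (torusChartInv j u)) /
          ‖gMap d m (torusChartInv j u)‖) •
        (ContinuousLinearMap.proj n : (Fin d → ℝ) →L[ℝ] ℝ)) u := by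
  simp only [norm_gMap] at hR ⊢
  have hS := fun h => hR ((Real.sqrt_eq_zero').2 (le_of_eq h))
  have := ((HasFDerivAt.fun_sum (u := Finset.univ)
    fun n _ => (hasFDerivAt_torusChartInv_im j u n).pow 2).add
      ((hasFDerivAt_lastCoord m j u).pow 2)).sqrt hS
  refine this.congr_fderiv ?_
  ext v
  simp only [smul_apply, add_apply,
    sum_apply, ContinuousLinearMap.proj_apply, smul_eq_mul, Finset.mul_sum,
    ← Finset.sum_add_distrib]
  refine Finset.sum_congr rfl fun n _ => ?_
  simp only [Pi.add_apply]
  field_simp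
  simp
  ring

/-- The Jacobian matrix of `fMap d m` in the charts `torusChart j` and `sphereChart i`, before the
permutation of its rows. -/
noncomputable def jacobianMatrix {d : ℕ} (m : ℝ) (j : Fin d → Fin 2) (s : ℝ) (u : Fin d → ℝ) :
    Matrix (Fin d) (Fin d) ℝ :=
  Matrix.diagonal (fun n => chartRate j u n * (torusChartInv j u n : ℂ).re /
      (‖gMap d m (torusChartInv j u)‖ - s * lastCoord m (torusChartInv j u))) +
    Matrix.vecMulVec (fun n => (torusChartInv j u n : ℂ).im)
      (fun n => -(chartRate j u n * (torusChartInv j u n : ℂ).im *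
        ((torusChartInv j u n : ℂ).re + lastCoord m (torusChartInv j u) -
          s * ‖gMap d m (torusChartInv j u)‖)) / (‖gMap d m (torusChartInv j u)‖ *
        (‖gMap d m (torusChartInv j u)‖ - s * lastCoord m (torusChartInv j u)) ^ 2))

theorem hasFDerivAt_chartRep {d : ℕ} [NeZero d] (hd : 2 ≤ d) {m : ℝ}
    (hm : ∀ k : ℕ, k ≤ d → m ≠ (d : ℝ) - 2 * k) (j : Fin d → Fin 2) (i : Fin 2) (u : Fin d → ℝ)
    (hW : ‖gMap d m (torusChartInv j u)‖ - poleSign i * lastCoord m (torusChartInv j u) ≠ 0) :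
    HasFDerivAt (chartRep (fMap d m hm) j i) (LinearMap.toContinuousLinearMap
      (Matrix.toLin' ((jacobianMatrix m j (poleSign i) u).submatrix (coordPerm i) id))) u := by
  have hR : ‖gMap d m (torusChartInv j u)‖ ≠ 0 := norm_ne_zero_iff.2 (gMap_ne_zero hm _)
  rw [hasFDerivAt_pi']
  intro k
  have hF : (fun u => chartRep (fMap d m hm) j i u k) = fun u =>
      (torusChartInv j u (coordPerm i k) : ℂ).im *
        (‖gMap d m (torusChartInv j u)‖ - poleSign i * lastCoord m (torusChartInv j u))⁻¹ := by
    funext u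
    rw [chartRep, sphereChart_fMap hd, div_eq_mul_inv]
  rw [hF]
  have h1 := (hasDerivAt_inv hW).comp_hasFDerivAt u ((hasFDerivAt_norm_gMap j u hR).sub
    ((hasFDerivAt_lastCoord m j u).const_mul (poleSign i)))
  refine ((hasFDerivAt_torusChartInv_im j u (coordPerm i k)).mul h1).congr_fderiv ?_
  ext v
  simp only [jacobianMatrix, smul_apply, add_apply,
    ContinuousLinearMap.comp_apply, LinearMap.coe_toContinuousLinearMap', Matrix.toLin'_apply,
    sub_apply, sum_apply, ContinuousLinearMap.proj_apply,
    smul_eq_mul, Matrix.mulVec, dotProduct, Matrix.submatrix_apply, id, Matrix.add_apply, add_mul,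
    Finset.sum_add_distrib, Matrix.vecMulVec_apply, Matrix.diagonal_apply, ite_mul, zero_mul]
  generalize coordPerm i k = l
  rw [Finset.sum_ite_eq, if_pos (Finset.mem_univ l), Finset.mul_sum, ← Finset.sum_sub_distrib,
    Finset.mul_sum, Finset.mul_sum, add_comm]
  congr 1
  · simp only [Function.comp_apply, Pi.sub_apply]
    ring
  · refine Finset.sum_congr rfl fun n _ => ?_
    field_simp

/-- With `W = R - s l` and `s² = 1`, the relations `∑ sin² = R² - l² = W (R + s l)` and `l - s R =
-s W` cancel the denominators `W` of the rank one part. What remains is the density times `s / R`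
and the factors common to all rows. -/
theorem det_jacobianMatrix {d : ℕ} {m : ℝ} (j : Fin d → Fin 2) {s : ℝ} (hs : s * s = 1)
    (u : Fin d → ℝ) (hR : ‖gMap d m (torusChartInv j u)‖ ≠ 0)
    (hW : ‖gMap d m (torusChartInv j u)‖ - s * lastCoord m (torusChartInv j u) ≠ 0) :
    (jacobianMatrix m j s u).det = s * ((∏ n, chartRate j u n) /
      (‖gMap d m (torusChartInv j u)‖ - s * lastCoord m (torusChartInv j u)) ^ d /
        ‖gMap d m (torusChartInv j u)‖) * jacobianDensity m (torusChartInv j u) := by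
  have hsum : ∑ n, (torusChartInv j u n : ℂ).im ^ 2 =
      ‖gMap d m (torusChartInv j u)‖ ^ 2 - lastCoord m (torusChartInv j u) ^ 2 := by
    rw [norm_gMap, Real.sq_sqrt (by positivity)]
    ring
  rw [jacobianMatrix, det_diagonal_add_vecMulVec, jacobianDensity]
  generalize ‖gMap d m (torusChartInv j u)‖ = R at *
  generalize lastCoord m (torusChartInv j u) = l at *
  generalize hW' : R - s * l = W at *
  have hprod : ∏ n, chartRate j u n / W = (∏ n, chartRate j u n) / W ^ d := by
    simp [Finset.prod_div_distrib]
  have h1 : ∀ n, chartRate j u n * (torusChartInv j u n : ℂ).re / W =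
    chartRate j u n / W * (torusChartInv j u n : ℂ).re := fun n => by ring
  simp only [h1, Finset.prod_mul_distrib]
  have h2 : ∀ n, (torusChartInv j u n : ℂ).im * (-(chartRate j u n *
      (torusChartInv j u n : ℂ).im * ((torusChartInv j u n : ℂ).re + l - s * R)) / (R * W ^ 2)) *
      ((∏ k ∈ Finset.univ.erase n, chartRate j u k / W) *
        ∏ k ∈ Finset.univ.erase n, (torusChartInv j u k : ℂ).re) =
      -((∏ n, chartRate j u n / W) / (R * W)) * ((torusChartInv j u n : ℂ).im ^ 2 *
        (∏ n, (torusChartInv j u n : ℂ).re)) - ((∏ n, chartRate j u n / W) / (R * W)) *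
        (l - s * R) * ((torusChartInv j u n : ℂ).im ^ 2 *
          ∏ k ∈ Finset.univ.erase n, (torusChartInv j u k : ℂ).re) := by
    intro n
    rw [← Finset.mul_prod_erase _ (fun n => chartRate j u n / W) (Finset.mem_univ n),
      ← Finset.mul_prod_erase _ (fun n => (torusChartInv j u n : ℂ).re) (Finset.mem_univ n)]
    field_simp
    ring
  simp only [h2, Finset.sum_sub_distrib, ← Finset.mul_sum, ← Finset.sum_mul, hsum, hprod]
  field_simp
  rw [← hW']
  generalize ∑ n, (torusChartInv j u n : ℂ).im ^ 2 *
    ∏ k ∈ Finset.univ.erase n, (torusChartInv j u k : ℂ).re = S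
  generalize ∏ n, (torusChartInv j u n : ℂ).re = P
  linear_combination (∏ n, chartRate j u n) * (l * S - P * l ^ 2) * hs

/-- The sign `s` left by `det_jacobianMatrix` is also the sign of the coordinate permutation in the
sphere chart, so the two cancel. Regularity and orientation signs can therefore be read off the
density alone. -/
theorem exists_jacobianDet_eq {d : ℕ} (hd : Even d) (hd0 : 0 < d) {m : ℝ}
    (hm : ∀ k : ℕ, k ≤ d → m ≠ (d : ℝ) - 2 * k) (j : Fin d → Fin 2) (i : Fin 2) {z : Torus d}
    (hz : z ∈ torusDomain j) (hi : fMap d m hm z ∈ sphereDomain i) :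
    ∃ c : ℝ, 0 < c ∧ jacobianDet (fMap d m hm) j i z = c * jacobianDensity m z := by
  have : NeZero d := ⟨hd0.ne'⟩
  have hd2 : 2 ≤ d := by
    obtain ⟨e, rfl⟩ := hd
    omega
  have hR : ‖gMap d m z‖ ≠ 0 := norm_ne_zero_iff.2 (gMap_ne_zero hm z)
  have hR0 : 0 < ‖gMap d m z‖ := lt_of_le_of_ne (norm_nonneg _) hR.symm
  rw [fMap_mem_sphereDomain] at hi
  have hs : poleSign i * poleSign i = 1 := by unfold poleSign; split_ifs <;> norm_num
  have hl : |lastCoord m z| ≤ ‖gMap d m z‖ := by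
    rw [norm_gMap]
    refine Real.abs_le_sqrt ?_
    have : 0 ≤ ∑ n, (z n : ℂ).im ^ 2 := by positivity
    linarith
  have hW : 0 < ‖gMap d m z‖ - poleSign i * lastCoord m z := by
    refine lt_of_le_of_ne ?_ hi.symm
    have h1 := abs_le.1 hl
    unfold poleSign
    split_ifs <;> linarith
  have hsign : ((Equiv.Perm.sign (coordPerm i : Equiv.Perm (Fin d)) : ℤ) : ℝ) = poleSign i := by
    obtain ⟨e, rfl⟩ : ∃ e, d = e + 2 := ⟨d - 2, by omega⟩
    unfold poleSign coordPerm
    split_ifs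
    · simp
    · rw [Equiv.Perm.sign_swap (by simp)]
      simp
  have hzz := torusChartInv_torusChart j hz
  refine ⟨(∏ n, chartRate j (torusChart j z) n) / (‖gMap d m z‖ - poleSign i * lastCoord m z) ^ d /
    ‖gMap d m z‖, ?_, ?_⟩
  · have := prod_chartRate_pos hd hd0 j (torusChart j z)
    positivity
  · have h := hasFDerivAt_chartRep hd2 hm j i (torusChart j z) (by rwa [hzz])
    rw [jacobianDet, h.fderiv, ContinuousLinearMap.det, LinearMap.coe_toContinuousLinearMap,
      LinearMap.det_toLin', Matrix.det_permute, hsign, det_jacobianMatrix j hs _ (by rwa [hzz])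
      (by rwa [hzz]), hzz]
    linear_combination ((∏ n, chartRate j (torusChart j z) n) /
      (‖gMap d m z‖ - poleSign i * lastCoord m z) ^ d / ‖gMap d m z‖) * jacobianDensity m z * hs

theorem isSmoothMap_fMap {d : ℕ} (hd : 2 ≤ d) {m : ℝ}
    (hm : ∀ k : ℕ, k ≤ d → m ≠ (d : ℝ) - 2 * k) : IsSmoothMap (fMap d m hm) := by
  have : NeZero d := ⟨by omega⟩
  constructor
  · refine Continuous.subtype_mk ?_ _
    have hg : Continuous (gMap d m) := by
      refine (PiLp.continuous_toLp 2 _).comp (continuous_pi fun k => ?_)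
      refine Fin.lastCases ?_ (fun n => ?_) k
      · simp only [Fin.snoc_last]
        fun_prop
      · simp only [Fin.snoc_castSucc]
        fun_prop
    exact (hg.norm.inv₀ fun z => norm_ne_zero_iff.2 (gMap_ne_zero hm z)).smul hg
  · intro j i u hu
    have hW := (fMap_mem_sphereDomain hm i _).1 hu
    refine ContDiffAt.contDiffWithinAt ?_
    rw [contDiffAt_pi]
    intro k
    have hre : ∀ n, ContDiff ℝ ∞ fun u : Fin d → ℝ => (torusChartInv j u n : ℂ).re := by
      intro n
      simp only [torusChartInv_re]
      exact contDiff_const.mul ((contDiff_const.mul (contDiff_apply ℝ ℝ n)).div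
        (contDiff_const.add ((contDiff_apply ℝ ℝ n).pow 2)) fun u => one_add_sq_ne_zero _)
    have him : ∀ n, ContDiff ℝ ∞ fun u : Fin d → ℝ => (torusChartInv j u n : ℂ).im := by
      intro n
      simp only [torusChartInv_im]
      exact contDiff_const.mul ((contDiff_const.sub ((contDiff_apply ℝ ℝ n).pow 2)).div
        (contDiff_const.add ((contDiff_apply ℝ ℝ n).pow 2)) fun u => one_add_sq_ne_zero _)
    have hl : ContDiff ℝ ∞ fun u : Fin d → ℝ => lastCoord m (torusChartInv j u) :=
      contDiff_const.sub (ContDiff.sum fun n _ => hre n)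
    have hR : ContDiff ℝ ∞ fun u : Fin d → ℝ => ‖gMap d m (torusChartInv j u)‖ := by
      simp only [norm_gMap]
      refine ((ContDiff.sum fun n _ => (him n).pow 2).add (hl.pow 2)).sqrt fun u h => ?_
      refine norm_ne_zero_iff.2 (gMap_ne_zero hm (torusChartInv j u)) ?_
      rw [norm_gMap, h, Real.sqrt_zero]
    simp only [chartRep, sphereChart_fMap hd]
    exact (him _).contDiffAt.div (hR.sub (contDiff_const.mul hl)).contDiffAt hW

/-! ### Signed count of simple zeros -/

theorem sign_eq_of_forall_ne_zero {h : ℝ → ℝ} {a b : ℝ} (hab : a ≤ b)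
    (hc : ContinuousOn h (Set.Icc a b)) (h0 : ∀ t ∈ Set.Icc a b, h t ≠ 0) :
    SignType.sign (h a) = SignType.sign (h b) := by
  rcases lt_or_gt_of_ne (h0 a ⟨le_rfl, hab⟩) with ha | ha <;>
    rcases lt_or_gt_of_ne (h0 b ⟨hab, le_rfl⟩) with hb | hb
  · rw [sign_neg ha, sign_neg hb]
  · obtain ⟨t, ht, h1⟩ := intermediate_value_Icc hab hc ⟨ha.le, hb.le⟩
    exact absurd h1 (h0 t ht)
  · obtain ⟨t, ht, h1⟩ := intermediate_value_Icc' hab hc ⟨hb.le, ha.le⟩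
    exact absurd h1 (h0 t ht)
  · rw [sign_pos ha, sign_pos hb]

theorem eventually_sign_slope {h : ℝ → ℝ} {D t : ℝ} (hD : HasDerivAt h D t) (hD0 : D ≠ 0)
    (ht : h t = 0) : ∀ᶠ u in nhdsWithin t {t}ᶜ,
      SignType.sign (h u) = SignType.sign (u - t) * SignType.sign D := by
  have h1 := hasDerivAt_iff_tendsto_slope.1 hD
  have h2 : ∀ᶠ y in nhds D, SignType.sign y = SignType.sign D := by
    rcases lt_or_gt_of_ne hD0 with h | h
    · filter_upwards [gt_mem_nhds h] with y hy
      rw [sign_neg hy, sign_neg h]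
    · filter_upwards [lt_mem_nhds h] with y hy
      rw [sign_pos hy, sign_pos h]
  filter_upwards [h1.eventually h2, self_mem_nhdsWithin] with u hu hut
  have hut : u - t ≠ 0 := sub_ne_zero.2 hut
  rw [← hu, ← sign_mul, slope_def_field, ht, sub_zero, mul_div_cancel₀ _ hut]

/-- An accumulation point of zeros would be a zero itself, interior because the end values do not
vanish; but a zero with nonvanishing derivative is isolated. -/
theorem finite_setOf_simple_zero {h h' : ℝ → ℝ} {a b : ℝ} (hc : ContinuousOn h (Set.Icc a b))
    (ha : h a ≠ 0) (hb : h b ≠ 0)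
    (hd : ∀ t ∈ Set.Ioo a b, h t = 0 → HasDerivAt h (h' t) t ∧ h' t ≠ 0) :
    {t | t ∈ Set.Ioo a b ∧ h t = 0}.Finite := by
  by_contra hinf
  obtain ⟨t, ht, hacc⟩ := Set.Infinite.exists_accPt_of_subset_isCompact
    (s := {t | t ∈ Set.Ioo a b ∧ h t = 0}) hinf
    (K := Set.Icc a b) isCompact_Icc (fun t ht => Set.Ioo_subset_Icc_self ht.1)
  rw [accPt_iff_frequently_nhdsNE] at hacc
  have h0 : h t = 0 := by
    by_contra hne
    have h1 : ∀ᶠ u in nhdsWithin t (Set.Icc a b), h u ≠ 0 := (hc t ht).eventually_ne hne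
    rw [eventually_nhdsWithin_iff] at h1
    refine hacc ((h1.filter_mono nhdsWithin_le_nhds).mono fun u hu hu2 => ?_)
    exact hu (Set.Ioo_subset_Icc_self hu2.1) hu2.2
  have ht' : t ∈ Set.Ioo a b :=
    ⟨lt_of_le_of_ne ht.1 fun h => ha (h ▸ h0), lt_of_le_of_ne ht.2 fun h => hb (h ▸ h0)⟩
  obtain ⟨h1, h2⟩ := hd t ht' h0
  exact hacc ((h1.eventually_ne h2 (c := 0)).mono fun u hu hu2 => hu hu2.2)

/-- Induction on the number of zeros: the leftmost one is removed by moving the left end `a` just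
past it, to `r`. Differentiability is required at the zeros only, since the square roots in
`branchFun` may be singular elsewhere. -/
theorem two_mul_sum_sign_of_card {h h' : ℝ → ℝ} {b : ℝ} (hb : h b ≠ 0) (n : ℕ) :
    ∀ a < b, ContinuousOn h (Set.Icc a b) → h a ≠ 0 →
      (∀ t ∈ Set.Ioo a b, h t = 0 → HasDerivAt h (h' t) t ∧ h' t ≠ 0) →
      ∀ Z : Finset ℝ, (∀ t, t ∈ Z ↔ t ∈ Set.Ioo a b ∧ h t = 0) → Z.card = n →
        2 * ∑ t ∈ Z, (SignType.sign (h' t) : ℤ) =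
          (SignType.sign (h b) : ℤ) - (SignType.sign (h a) : ℤ) := by
  induction n with
  | zero =>
    intro a hab hc ha _ Z hZ hcard
    rw [Finset.card_eq_zero] at hcard
    subst hcard
    rw [sign_eq_of_forall_ne_zero hab.le hc]
    · simp
    · intro t ht h0
      refine absurd ((hZ t).2 ⟨⟨lt_of_le_of_ne ht.1 ?_, lt_of_le_of_ne ht.2 ?_⟩, h0⟩)
        (Finset.notMem_empty t)
      · rintro rfl
        exact ha h0
      · rintro rfl
        exact hb h0
  | succ n ih =>
    intro a hab hc ha hd Z hZ hcard
    have hne : Z.Nonempty := Finset.card_pos.1 (by omega)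
    have hmin : ∀ z ∈ Z, Z.min' hne ≤ z := fun z hz => Finset.min'_le Z z hz
    have hmem := Finset.min'_mem Z hne
    generalize Z.min' hne = t at hmin hmem
    obtain ⟨⟨hat, htb⟩, h0⟩ := (hZ t).1 hmem
    obtain ⟨hD, hD0⟩ := hd t ⟨hat, htb⟩ h0
    have hev := eventually_sign_slope hD hD0 h0
    obtain ⟨l, hl1, hl2, hl3⟩ : ∃ l, a < l ∧ l < t ∧
        SignType.sign (h l) = SignType.sign (l - t) * SignType.sign (h' t) := by
      have h1 : ∀ᶠ u in nhdsWithin t (Set.Iio t), SignType.sign (h u) =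
          SignType.sign (u - t) * SignType.sign (h' t) :=
        hev.filter_mono (nhdsWithin_mono _ fun u hu => ne_of_lt hu)
      have h2 : ∀ᶠ u in nhdsWithin t (Set.Iio t), a < u :=
        (lt_mem_nhds hat).filter_mono nhdsWithin_le_nhds
      obtain ⟨l, ⟨h3, h4⟩, h5⟩ := ((h1.and h2).and self_mem_nhdsWithin).exists
      exact ⟨l, h4, h5, h3⟩
    obtain ⟨r, hr1, hr2, hr3, hr4⟩ : ∃ r, t < r ∧ r < b ∧
        SignType.sign (h r) = SignType.sign (r - t) * SignType.sign (h' t) ∧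
        ∀ z ∈ Z.erase t, r < z := by
      have h1 : ∀ᶠ u in nhdsWithin t (Set.Ioi t), SignType.sign (h u) =
          SignType.sign (u - t) * SignType.sign (h' t) :=
        hev.filter_mono (nhdsWithin_mono _ fun u hu => ne_of_gt hu)
      have h2 : ∀ᶠ u in nhdsWithin t (Set.Ioi t), u < b :=
        (gt_mem_nhds htb).filter_mono nhdsWithin_le_nhds
      have h3 : ∀ᶠ u in nhdsWithin t (Set.Ioi t), ∀ z ∈ Z.erase t, u < z := by
        rw [Filter.eventually_all_finset]
        intro z hz
        refine (gt_mem_nhds ?_).filter_mono nhdsWithin_le_nhds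
        exact lt_of_le_of_ne (hmin z (Finset.mem_of_mem_erase hz)) (Finset.ne_of_mem_erase hz).symm
      obtain ⟨r, ⟨⟨h3, h4⟩, h5⟩, h6⟩ := (((h1.and h2).and h3).and self_mem_nhdsWithin).exists
      exact ⟨r, h6, h4, h3, h5⟩
    rw [sign_neg (sub_neg.2 hl2)] at hl3
    rw [sign_pos (sub_pos.2 hr1), one_mul] at hr3
    -- No zero lies between `a` and `l`, because `t` is the leftmost one.
    have hsa : SignType.sign (h a) = SignType.sign (h l) := by
      refine sign_eq_of_forall_ne_zero hl1.le
        (hc.mono (Set.Icc_subset_Icc le_rfl (by linarith))) fun u hu hu0 => ?_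
      rcases eq_or_lt_of_le hu.1 with rfl | hau
      · exact ha hu0
      · have := hmin u ((hZ u).2 ⟨⟨hau, by linarith [hu.2]⟩, hu0⟩)
        linarith [hu.2]
    have hr0 : h r ≠ 0 := by
      rw [← sign_ne_zero, hr3, sign_ne_zero]
      exact hD0
    have := ih r hr2 (hc.mono (Set.Icc_subset_Icc (by linarith) le_rfl)) hr0
      (fun u hu => hd u ⟨by linarith [hu.1], hu.2⟩) (Z.erase t) (fun u => ?_)
      (by rw [Finset.card_erase_of_mem hmem, hcard]; rfl)
    · rw [← Finset.add_sum_erase Z _ hmem, mul_add, this, hsa, hl3, hr3]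
      simp only [SignType.coe_mul, SignType.coe_neg, SignType.coe_one]
      ring
    · constructor
      · intro hu
        have h1 := (hZ u).1 (Finset.mem_of_mem_erase hu)
        exact ⟨⟨hr4 u hu, h1.1.2⟩, h1.2⟩
      · rintro ⟨⟨h1, h2⟩, h3⟩
        exact Finset.mem_erase.2 ⟨(hr1.trans h1).ne', (hZ u).2 ⟨⟨by linarith, h2⟩, h3⟩⟩

/-- The signs of the derivatives at the zeros of a function with only simple zeros add up to half
of the difference of the signs at the end points. -/
theorem two_mul_sum_sign_deriv {h h' : ℝ → ℝ} {a b : ℝ} (hab : a < b)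
    (hc : ContinuousOn h (Set.Icc a b)) (ha : h a ≠ 0) (hb : h b ≠ 0)
    (hd : ∀ t ∈ Set.Ioo a b, h t = 0 → HasDerivAt h (h' t) t ∧ h' t ≠ 0) {Z : Finset ℝ}
    (hZ : ∀ t, t ∈ Z ↔ t ∈ Set.Ioo a b ∧ h t = 0) :
    2 * ∑ t ∈ Z, (SignType.sign (h' t) : ℤ) =
      (SignType.sign (h b) : ℤ) - (SignType.sign (h a) : ℤ) :=
  two_mul_sum_sign_of_card hb Z.card a hab hc ha hd Z hZ rfl

/-! ### Signed sums over sign vectors -/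

/-- A sign vector with exactly `k` entries `-1` has product `(-1)^k` and sum `d - 2k`. -/
theorem sum_prod_units_mul (d : ℕ) (F : ℝ → ℤ) :
    ∑ ε : Fin d → ℤˣ, ((∏ n, ε n : ℤˣ) : ℤ) * F (∑ n, ((ε n : ℤ) : ℝ)) =
      ∑ k ∈ Finset.range (d + 1), (-1) ^ k * (d.choose k : ℤ) * F ((d : ℝ) - 2 * k) := by
  have h1 : ∑ ε : Fin d → ℤˣ, ((∏ n, ε n : ℤˣ) : ℤ) * F (∑ n, ((ε n : ℤ) : ℝ)) =
      ∑ S : Finset (Fin d), (-1) ^ S.card * F ((d : ℝ) - 2 * S.card) := by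
    symm
    refine Finset.sum_bij' (fun S _ n => if n ∈ S then -1 else 1)
      (fun ε _ => Finset.univ.filter fun n => ε n = -1) (by simp) (by simp) ?_ ?_ ?_
    · intro S _
      ext n
      by_cases h : n ∈ S <;> simp [h]
    · intro ε _
      funext n
      rcases Int.units_eq_one_or (ε n) with h | h <;> simp [h]
    · intro S _
      congr 1
      · rw [Finset.prod_ite_mem, Finset.univ_inter]
        simp
      · congr 1
        have : ∀ n, (((if n ∈ S then -1 else 1 : ℤˣ) : ℤ) : ℝ) = 1 - 2 * if n ∈ S then 1 else 0 := by
          intro n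
          split_ifs <;> norm_num
        simp only [this, Finset.sum_sub_distrib, ← Finset.mul_sum]
        simp
  rw [h1, ← Finset.powerset_univ,
    Finset.sum_powerset_apply_card fun k => (-1) ^ k * F ((d : ℝ) - 2 * k)]
  simp only [Finset.card_univ, Fintype.card_fin, nsmul_eq_mul]
  exact Finset.sum_congr rfl fun k _ => by ring

/-- The sum of `∏ ε_n sgn (m - ∑ ε_n)` over all sign vectors `ε`. -/
noncomputable def signSum (d : ℕ) (m : ℝ) : ℤ :=
  ∑ ε : Fin d → ℤˣ, ((∏ n, ε n : ℤˣ) : ℤ) * (SignType.sign (m - ∑ n, ((ε n : ℤ) : ℝ)) : ℤ)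

theorem sum_prod_units {d : ℕ} (hd : 0 < d) :
    ∑ ε : Fin d → ℤˣ, ((∏ n, ε n : ℤˣ) : ℤ) = 0 := by
  have := sum_prod_units_mul d (fun _ => 1)
  simp only [mul_one] at this
  rw [this, Int.alternating_sum_range_choose_of_ne hd.ne']

/-- The substitution `ε ↦ -ε` preserves `∏ ε_n` for even `d` and reverses the argument of the sign.
-/
theorem signSum_neg {d : ℕ} (hd : Even d) (m : ℝ) : signSum d (-m) = -signSum d m := by
  unfold signSum
  rw [← Finset.sum_neg_distrib]
  refine Fintype.sum_equiv (Equiv.neg _) _ _ fun ε => ?_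
  have h1 : ∏ n, (Equiv.neg (Fin d → ℤˣ)) ε n = ∏ n, ε n := by
    simp [Finset.prod_neg, hd.neg_one_pow]
  have h2 : m - ∑ n, (((Equiv.neg (Fin d → ℤˣ)) ε n : ℤ) : ℝ) = -(-m - ∑ n, ((ε n : ℤ) : ℝ)) := by
    simp
    ring
  rw [h1, h2, Left.sign_neg]
  simp

/-- The sign of `m - (d - 2k)` is `1 - 2·[k < K]`, and the constant `1` contributes the full
alternating binomial sum, which vanishes for `d > 0`. -/
theorem signSum_eq_of_threshold {d K : ℕ} (hd : 0 < d) (hK : K ≤ d + 1) {m : ℝ}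
    (h1 : ∀ k < K, m < (d : ℝ) - 2 * k) (h2 : ∀ k, K ≤ k → (d : ℝ) - 2 * k < m) :
    -signSum d m = 2 * ∑ k ∈ Finset.range K, (-1 : ℤ) ^ k * (d.choose k : ℤ) := by
  have h3 := sum_prod_units_mul d (fun x => (SignType.sign (m - x) : ℤ))
  rw [signSum, h3]
  have h4 : ∀ k : ℕ, (SignType.sign (m - ((d : ℝ) - 2 * k)) : ℤ) = 1 - 2 * if k < K then 1 else 0 := by
    intro k
    split_ifs with h
    · rw [sign_neg (sub_neg.2 (h1 k h))]; rfl
    · rw [sign_pos (sub_pos.2 (h2 k (not_lt.1 h)))]; rfl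
  have h5 := Int.alternating_sum_range_choose_of_ne hd.ne'
  have h6 : ∑ k ∈ Finset.range K, (-1 : ℤ) ^ k * (d.choose k : ℤ) =
      ∑ k ∈ Finset.range (d + 1), (-1 : ℤ) ^ k * (d.choose k : ℤ) * if k < K then 1 else 0 := by
    rw [← Finset.sum_subset (Finset.range_mono hK)]
    · exact Finset.sum_congr rfl fun k hk => by rw [if_pos (Finset.mem_range.1 hk), mul_one]
    · intro k _ hk
      rw [if_neg (by simpa using hk), mul_zero]
  simp only [h4, mul_sub, Finset.sum_sub_distrib, mul_one, h5, h6, mul_left_comm _ (2 : ℤ),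
    ← Finset.mul_sum]
  ring

theorem signSum_eq_of_mem_Ioo {d n : ℕ} (hd : Even d) (hn : Odd n) (hnd : n < d + 1)
    {m : ℝ} (hm : m ∈ Set.Ioo ((n : ℝ) - 1) ((n : ℝ) + 1)) :
    -signSum d m =
      2 * ∑ k ∈ Finset.range ((d - n - 1) / 2 + 1), (-1 : ℤ) ^ k * (d.choose k : ℤ) := by
  obtain ⟨a, rfl⟩ := hd
  obtain ⟨b, rfl⟩ := hn
  have hb : b < a := by omega
  obtain ⟨c, rfl⟩ := Nat.exists_eq_add_of_lt hb
  obtain ⟨hm1, hm2⟩ := hm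
  push_cast at hm1 hm2
  -- Parity forces `n ≤ d - 1`, so neither the subtractions nor the halving truncate: `(d - n - 1) /
  -- 2 = c`.
  have hK : (b + c + 1 + (b + c + 1) - (2 * b + 1) - 1) / 2 + 1 = c + 1 := by omega
  rw [hK]
  refine signSum_eq_of_threshold (by omega) (by omega) ?_ ?_
  · intro k hk
    have : (k : ℝ) ≤ c := by exact_mod_cast Nat.lt_succ_iff.1 hk
    push_cast
    linarith
  · intro k hk
    have : (c : ℝ) + 1 ≤ k := by exact_mod_cast hk
    push_cast
    linarith

theorem signSum_eq_zero {d : ℕ} (hd : Even d) (hd0 : 0 < d) {m : ℝ} (hm : (d : ℝ) < |m|) :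
    signSum d m = 0 := by
  have h : ∀ m : ℝ, (d : ℝ) < m → signSum d m = 0 := by
    intro m hm
    have := signSum_eq_of_threshold hd0 (Nat.zero_le _) (m := m) (by simp) fun k _ => by
      have : (0 : ℝ) ≤ k := k.cast_nonneg
      linarith
    simpa using this
  rcases lt_abs.1 hm with h1 | h1
  · exact h m h1
  · have := h _ h1
    rwa [signSum_neg hd, neg_eq_zero] at this

/-- Splitting off the `l`-th sign leaves the differences of the end signs of `branchFun` at `c = 1`
and `c = -1`. -/
theorem signSum_succ {d : ℕ} (l : Fin (d + 1)) (m : ℝ) :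
    signSum (d + 1) m = ∑ ε : Fin d → ℤˣ, ((∏ n, ε n : ℤˣ) : ℤ) *
      ((SignType.sign (m - 1 - ∑ n, ((ε n : ℤ) : ℝ)) : ℤ) -
        (SignType.sign (m + 1 - ∑ n, ((ε n : ℤ) : ℝ)) : ℤ)) := by
  rw [signSum, ← (Fin.insertNthEquiv (fun _ => ℤˣ) l).sum_comp, Fintype.sum_prod_type]
  simp only [Fin.insertNthEquiv_apply, Fin.prod_univ_succAbove _ l, Fin.sum_univ_succAbove _ l,
    Fin.insertNth_apply_same, Fin.insertNth_apply_succAbove]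
  rw [show (Finset.univ : Finset ℤˣ) = {1, -1} from rfl, Finset.sum_pair (by decide),
    ← Finset.sum_add_distrib]
  refine Finset.sum_congr rfl fun ε _ => ?_
  simp only [one_mul, neg_mul, Units.val_neg, Units.val_one, Int.cast_one, Int.cast_neg,
    sub_add_eq_sub_sub, sub_neg_eq_add]
  ring

theorem sign_units_mul (u : ℤˣ) (y : ℝ) :
    (SignType.sign (((u : ℤ) : ℝ) * y) : ℤ) = u * (SignType.sign y : ℤ) := by
  rcases Int.units_eq_one_or u with rfl | rfl
  · simp
  · simp [Left.sign_neg]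

/-! ### Points of the torus with given coordinates -/

/-- The point of the circle with given real and imaginary part. -/
def circleMk (x y : ℝ) (h : x ^ 2 + y ^ 2 = 1) : Circle :=
  ⟨⟨x, y⟩, by
    rw [Submonoid.unitSphere, ← SetLike.mem_coe, Submonoid.coe_set_mk, Subsemigroup.coe_set_mk,
      mem_sphere_zero_iff_norm, ← sq_eq_sq₀ (norm_nonneg _) zero_le_one,
      ← Complex.normSq_eq_norm_sq, Complex.normSq_mk]
    linarith⟩

theorem circleMk_re {x y : ℝ} (h : x ^ 2 + y ^ 2 = 1) : (circleMk x y h : ℂ).re = x := rfl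

theorem circle_re_sq_add_im_sq (w : Circle) : (w : ℂ).re ^ 2 + (w : ℂ).im ^ 2 = 1 := by
  have h1 : Complex.normSq (w : ℂ) = 1 := Circle.normSq_coe w
  rw [Complex.normSq_apply] at h1
  linarith

theorem units_cast_sq (u : ℤˣ) : ((u : ℤ) : ℝ) ^ 2 = 1 := by
  rcases Int.units_eq_one_or u with rfl | rfl <;> norm_num

/-- The point of the torus with coordinates `±1`. -/
def signPoint {d : ℕ} (ε : Fin d → ℤˣ) : Torus d :=
  fun n => circleMk ((ε n : ℤ) : ℝ) 0 (by rw [units_cast_sq]; norm_num)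

theorem signPoint_re {d : ℕ} (ε : Fin d → ℤˣ) (n : Fin d) :
    (signPoint ε n : ℂ).re = ((ε n : ℤ) : ℝ) := rfl

theorem signPoint_im {d : ℕ} (ε : Fin d → ℤˣ) (n : Fin d) : (signPoint ε n : ℂ).im = 0 := rfl

theorem lastCoord_signPoint {d : ℕ} (m : ℝ) (ε : Fin d → ℤˣ) :
    lastCoord m (signPoint ε) = m - ∑ n, ((ε n : ℤ) : ℝ) := rfl

theorem sub_sum_units_ne_zero {d : ℕ} {m : ℝ} (hm : ∀ k : ℕ, k ≤ d → m ≠ (d : ℝ) - 2 * k)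
    (ε : Fin d → ℤˣ) : m - ∑ n, ((ε n : ℤ) : ℝ) ≠ 0 := by
  intro h
  refine gMap_ne_zero hm (signPoint ε) (norm_eq_zero.1 ?_)
  rw [norm_gMap, lastCoord_signPoint, h]
  simp [signPoint_im]

theorem fMap_eq_iff {d : ℕ} {m : ℝ} (hm : ∀ k : ℕ, k ≤ d → m ≠ (d : ℝ) - 2 * k) (z : Torus d)
    (p : Sphere d) : fMap d m hm z = p ↔ ∃ t : ℝ, 0 < t ∧
      (∀ n, (z n : ℂ).im = t * (p : EuclideanSpace ℝ (Fin (d + 1))) (Fin.castSucc n)) ∧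
      lastCoord m z = t * (p : EuclideanSpace ℝ (Fin (d + 1))) (Fin.last d) := by
  have hR : ‖gMap d m z‖ ≠ 0 := norm_ne_zero_iff.2 (gMap_ne_zero hm z)
  constructor
  · rintro rfl
    refine ⟨‖gMap d m z‖, lt_of_le_of_ne (norm_nonneg _) hR.symm, fun n => ?_, ?_⟩
    · rw [fMap_apply, gMap_castSucc, mul_inv_cancel_left₀ hR]
    · rw [fMap_apply, gMap_last, mul_inv_cancel_left₀ hR]
  · rintro ⟨t, ht, h1, h2⟩
    have hg : gMap d m z = t • (p : EuclideanSpace ℝ (Fin (d + 1))) := by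
      ext k
      refine Fin.lastCases ?_ (fun n => ?_) k
      · rw [gMap_last, h2]; rfl
      · rw [gMap_castSucc, h1]; rfl
    have hn : ‖gMap d m z‖ = t := by
      rw [hg, norm_smul, Real.norm_of_nonneg ht.le, norm_eq_of_mem_sphere p, mul_one]
    apply Subtype.ext
    change ‖gMap d m z‖⁻¹ • gMap d m z = p
    rw [hn, hg, inv_smul_smul₀ ht.ne']

/-! ### The poles -/

theorem jacobianDensity_signPoint {d : ℕ} (m : ℝ) (ε : Fin d → ℤˣ) :
    jacobianDensity m (signPoint ε) =
      (((∏ n, ε n : ℤˣ) : ℤ) : ℝ) * -(m - ∑ n, ((ε n : ℤ) : ℝ)) := by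
  simp only [jacobianDensity, signPoint_im, signPoint_re, lastCoord_signPoint]
  push_cast
  simp
  ring

/-- Over a pole all sines vanish, so the cosines are `±1`, and only the sign of the last coordinate
decides which pole is hit. -/
theorem fMap_eq_pole_iff {d : ℕ} {m : ℝ} (hm : ∀ k : ℕ, k ≤ d → m ≠ (d : ℝ) - 2 * k)
    (z : Torus d) {p : Sphere d}
    (hp : ∀ n : Fin d, (p : EuclideanSpace ℝ (Fin (d + 1))) n.castSucc = 0) :
    fMap d m hm z = p ↔ ∃ ε : Fin d → ℤˣ, signPoint ε = z ∧
      SignType.sign (m - ∑ n, ((ε n : ℤ) : ℝ)) =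
        SignType.sign ((p : EuclideanSpace ℝ (Fin (d + 1))) (Fin.last d)) := by
  rw [fMap_eq_iff]
  constructor
  · rintro ⟨t, ht, h1, h2⟩
    have him : ∀ n, (z n : ℂ).im = 0 := fun n => by rw [h1, hp, mul_zero]
    have hz : signPoint (fun n => if (z n : ℂ).re = 1 then 1 else -1) = z := by
      funext n
      have h3 := circle_re_sq_add_im_sq (z n)
      rw [him, zero_pow two_ne_zero, add_zero, sq_eq_one_iff] at h3
      refine Circle.ext (Complex.ext ?_ (him n).symm)
      rw [signPoint_re]
      rcases h3 with h3 | h3 <;> rw [h3] <;> norm_num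
    refine ⟨_, hz, ?_⟩
    rw [← lastCoord_signPoint, hz, h2, sign_mul, sign_pos ht, one_mul]
  · rintro ⟨ε, rfl, h⟩
    have hne := sub_sum_units_ne_zero hm ε
    rw [← lastCoord_signPoint] at h hne
    generalize lastCoord m (signPoint ε) = x at *
    generalize (p : EuclideanSpace ℝ (Fin (d + 1))) (Fin.last d) = q at *
    have hq : q ≠ 0 := by
      rw [← sign_ne_zero, ← h, sign_ne_zero]
      exact hne
    refine ⟨x / q, ?_, fun n => by rw [hp, mul_zero]; rfl, by field_simp⟩
    rcases lt_or_gt_of_ne hq with h1 | h1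
    · rw [sign_neg h1, sign_eq_neg_one_iff] at h
      exact div_pos_of_neg_of_neg h h1
    · rw [sign_pos h1, sign_eq_one_iff] at h
      positivity

theorem signPoint_injective {d : ℕ} : Function.Injective (signPoint (d := d)) := by
  intro ε ε' h
  funext n
  have h1 : (signPoint ε n : ℂ).re = (signPoint ε' n : ℂ).re := by rw [h]
  rw [signPoint_re, signPoint_re] at h1
  exact Units.ext (by exact_mod_cast h1)

theorem sum_sign_jacobianDensity_of_pole {d : ℕ} (hd : 0 < d) {m : ℝ}
    (hm : ∀ k : ℕ, k ≤ d → m ≠ (d : ℝ) - 2 * k) {p : Sphere d}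
    (hp : ∀ n : Fin d, (p : EuclideanSpace ℝ (Fin (d + 1))) n.castSucc = 0) :
    ∃ hfin : (fMap d m hm ⁻¹' {p}).Finite,
      2 * ∑ z ∈ hfin.toFinset, (SignType.sign (jacobianDensity m z) : ℤ) = -signSum d m := by
  obtain ⟨σ, hσ⟩ : ∃ σ, σ = SignType.sign ((p : EuclideanSpace ℝ (Fin (d + 1))) (Fin.last d)) :=
    ⟨_, rfl⟩
  have hpre : fMap d m hm ⁻¹' {p} = ((Finset.univ.filter fun ε : Fin d → ℤˣ =>
      SignType.sign (m - ∑ n, ((ε n : ℤ) : ℝ)) = σ).map ⟨signPoint, signPoint_injective⟩ :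
        Finset (Torus d)) := by
    ext z
    rw [Set.mem_preimage, Set.mem_singleton_iff, fMap_eq_pole_iff hm z hp, ← hσ]
    simp only [Finset.coe_map, Set.mem_image, Finset.mem_coe, Finset.mem_filter, Finset.mem_univ,
      true_and, Function.Embedding.coeFn_mk]
    exact exists_congr fun ε => and_comm
  refine ⟨hpre ▸ Finset.finite_toSet _, ?_⟩
  have hfs : ∀ hfin : (fMap d m hm ⁻¹' {p}).Finite, hfin.toFinset = (Finset.univ.filter
      fun ε : Fin d → ℤˣ => SignType.sign (m - ∑ n, ((ε n : ℤ) : ℝ)) = σ).map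
        ⟨signPoint, signPoint_injective⟩ := by
    intro hfin
    rw [← Finset.coe_inj, Set.Finite.coe_toFinset, hpre]
  rw [hfs, Finset.sum_map, Finset.sum_filter]
  have hq : σ ≠ 0 := by
    rw [hσ, sign_ne_zero]
    intro h0
    have h1 := norm_eq_of_mem_sphere p
    rw [EuclideanSpace.norm_eq, Fin.sum_univ_castSucc, h0] at h1
    simp [hp] at h1
  -- For nonzero signs `τ`, `σ` one has `2·[τ = σ]·τ = τ + σ`. The part with `σ` drops out after
  -- summation because `∑ ∏ ε_n = 0`, so both poles give the same count.
  have hterm : ∀ ε : Fin d → ℤˣ, 2 * (if SignType.sign (m - ∑ n, ((ε n : ℤ) : ℝ)) = σ then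
      (SignType.sign (jacobianDensity m (signPoint ε)) : ℤ) else 0) =
      -(((∏ n, ε n : ℤˣ) : ℤ) * (SignType.sign (m - ∑ n, ((ε n : ℤ) : ℝ)) : ℤ)) -
        (σ : ℤ) * ((∏ n, ε n : ℤˣ) : ℤ) := by
    intro ε
    clear hpre hfs hσ
    have hne := sub_sum_units_ne_zero hm ε
    rw [jacobianDensity_signPoint, sign_units_mul, Left.sign_neg]
    rw [← sign_ne_zero] at hne
    generalize SignType.sign (m - ∑ n, ((ε n : ℤ) : ℝ)) = τ at *
    generalize ((∏ n, ε n : ℤˣ) : ℤ) = P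
    rcases SignType.trichotomy τ with h | h | h <;> rcases SignType.trichotomy σ with h' | h' | h' <;>
      simp_all <;> ring
  simp only [Function.Embedding.coeFn_mk]
  rw [Finset.mul_sum, Finset.sum_congr rfl fun ε _ => hterm ε, Finset.sum_sub_distrib,
    ← Finset.mul_sum, sum_prod_units hd, Finset.sum_neg_distrib, signSum]
  simp

/-- Poles are thus always regular, which settles the existence of regular values. -/
theorem jacobianDensity_ne_zero_of_pole {d : ℕ} {m : ℝ}
    (hm : ∀ k : ℕ, k ≤ d → m ≠ (d : ℝ) - 2 * k) {p : Sphere d}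
    (hp : ∀ n : Fin d, (p : EuclideanSpace ℝ (Fin (d + 1))) n.castSucc = 0) {z : Torus d}
    (hz : fMap d m hm z = p) : jacobianDensity m z ≠ 0 := by
  obtain ⟨ε, rfl, -⟩ := (fMap_eq_pole_iff hm z hp).1 hz
  rw [jacobianDensity_signPoint]
  exact mul_ne_zero (by exact_mod_cast Units.ne_zero _) (neg_ne_zero.2 (sub_sum_units_ne_zero hm ε))

/-! ### The branches of the preimage of a ray -/

/-- The cosines of the other angles, as functions of the cosine `c` of the distinguished one. -/
noncomputable def branch {e : ℕ} (r : Fin e → ℝ) (ε : Fin e → ℤˣ) (c : ℝ) (i : Fin e) : ℝ :=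
  ((ε i : ℤ) : ℝ) * √(1 - r i ^ 2 * (1 - c ^ 2))

/-- The function whose zeros are the preimages on the branch `ε`. -/
noncomputable def branchFun {e : ℕ} (m q : ℝ) (r : Fin e → ℝ) (ε : Fin e → ℤˣ) (c : ℝ) : ℝ :=
  m - q * √(1 - c ^ 2) - c - ∑ i, branch r ε c i

/-- The derivative of `branchFun`. -/
noncomputable def branchDeriv {e : ℕ} (q : ℝ) (r : Fin e → ℝ) (ε : Fin e → ℤˣ) (c : ℝ) : ℝ :=
  q * (c / √(1 - c ^ 2)) - 1 -
    ∑ i, ((ε i : ℤ) : ℝ) * (r i ^ 2 * c / √(1 - r i ^ 2 * (1 - c ^ 2)))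

theorem one_sub_sq_pos {c : ℝ} (hc : c ∈ Set.Ioo (-1 : ℝ) 1) : 0 < 1 - c ^ 2 := by
  nlinarith [hc.1, hc.2]

theorem radicand_nonneg {r c : ℝ} (hr : r ^ 2 ≤ 1) (hc : 0 ≤ 1 - c ^ 2) :
    0 ≤ 1 - r ^ 2 * (1 - c ^ 2) := by
  nlinarith [mul_le_mul_of_nonneg_right hr hc, sq_nonneg c]

theorem hasDerivAt_branchFun {e : ℕ} (m q : ℝ) {r : Fin e → ℝ} (ε : Fin e → ℤˣ) {c : ℝ}
    (hc : c ∈ Set.Ioo (-1 : ℝ) 1) (hr : ∀ i, 1 - r i ^ 2 * (1 - c ^ 2) ≠ 0) :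
    HasDerivAt (branchFun m q r ε) (branchDeriv q r ε c) c := by
  have h1 : HasDerivAt (fun c : ℝ => 1 - c ^ 2) (-(2 * c)) c := by
    simpa using ((hasDerivAt_id c).pow 2).const_sub 1
  have h2 := h1.sqrt (one_sub_sq_pos hc).ne'
  have h3 : ∀ i ∈ Finset.univ, HasDerivAt (fun c => branch r ε c i)
      (((ε i : ℤ) : ℝ) * (r i ^ 2 * c / √(1 - r i ^ 2 * (1 - c ^ 2)))) c := by
    intro i _
    have h4 := (((h1.const_mul (r i ^ 2)).const_sub 1).sqrt (hr i)).const_mul ((ε i : ℤ) : ℝ)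
    refine h4.congr_deriv ?_
    congr 1
    rw [show -(r i ^ 2 * -(2 * c)) = 2 * (r i ^ 2 * c) by ring, mul_div_mul_left _ _ two_ne_zero]
  have h5 := (((h2.const_mul q).const_sub m).sub (hasDerivAt_id c)).sub (HasDerivAt.fun_sum h3)
  refine h5.congr_deriv ?_
  rw [branchDeriv, neg_div, mul_div_mul_left _ _ two_ne_zero]
  ring

theorem continuous_branchFun {e : ℕ} (m q : ℝ) (r : Fin e → ℝ) (ε : Fin e → ℤˣ) :
    Continuous (branchFun m q r ε) := by
  unfold branchFun branch
  fun_prop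

/-- The parameters `q` and `r`, which carry `p`, drop out at the ends; this makes the count
independent of `p`. -/
theorem branchFun_of_sq_eq_one {e : ℕ} (m q : ℝ) (r : Fin e → ℝ) (ε : Fin e → ℤˣ) {c : ℝ}
    (hc : c ^ 2 = 1) : branchFun m q r ε c = m - c - ∑ i, ((ε i : ℤ) : ℝ) := by
  simp [branchFun, branch, hc]

theorem prod_univ_erase_eq_prod_succAbove {e : ℕ} (l : Fin (e + 1)) (x : Fin (e + 1) → ℝ) :
    ∏ k ∈ Finset.univ.erase l, x k = ∏ i, x (l.succAbove i) := by
  rw [Fin.univ_succAbove _ l, Finset.erase_cons, Finset.prod_map]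
  rfl

/-- The sines enter the density only through their squares, all proportional to `1 - c²`. Factoring
out `(1 - c²) ∏ branch` leaves `-branchDeriv`, and `∏ branch` is `∏ ε_i` times a positive number. -/
theorem jacobianDensity_eq_branchDeriv {e : ℕ} {m q c : ℝ} {r : Fin e → ℝ} {ε : Fin e → ℤˣ}
    (hc : c ∈ Set.Ioo (-1 : ℝ) 1) (hr : ∀ i, 0 < 1 - r i ^ 2 * (1 - c ^ 2))
    {z : Torus (e + 1)} {l : Fin (e + 1)} (hre : (z l : ℂ).re = c)
    (hre' : ∀ i, (z (l.succAbove i) : ℂ).re = branch r ε c i)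
    (him : ∀ i, (z (l.succAbove i) : ℂ).im ^ 2 = r i ^ 2 * (1 - c ^ 2))
    (hlast : lastCoord m z = q * √(1 - c ^ 2)) :
    jacobianDensity m z = (((∏ i, ε i : ℤˣ) : ℤ) : ℝ) *
      (-((1 - c ^ 2) * ∏ i, √(1 - r i ^ 2 * (1 - c ^ 2))) * branchDeriv q r ε c) := by
  have hs := one_sub_sq_pos hc
  have hprod : ∏ i, branch r ε c i = (((∏ i, ε i : ℤˣ) : ℤ) : ℝ) *
      ∏ i, √(1 - r i ^ 2 * (1 - c ^ 2)) := by
    simp [branch, Finset.prod_mul_distrib]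
  have hb : ∀ i, branch r ε c i ≠ 0 := fun i =>
    mul_ne_zero (by exact_mod_cast Units.ne_zero _) (Real.sqrt_pos.2 (hr i)).ne'
  have hex : ∀ i, ∏ k ∈ Finset.univ.erase (l.succAbove i), (z k : ℂ).re =
      c * (∏ i, branch r ε c i) / branch r ε c i := by
    intro i
    have h1 := Finset.mul_prod_erase Finset.univ (fun k => (z k : ℂ).re)
      (Finset.mem_univ (l.succAbove i))
    rw [Fin.prod_univ_succAbove _ l] at h1
    simp only [hre, hre'] at h1
    rw [eq_div_iff (hb i), mul_comm, h1]
  have hl : (z l : ℂ).im ^ 2 = 1 - c ^ 2 := by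
    rw [← hre]
    linarith [circle_re_sq_add_im_sq (z l)]
  have hterm : ∀ i, ((ε i : ℤ) : ℝ) * (r i ^ 2 * c / √(1 - r i ^ 2 * (1 - c ^ 2))) =
      r i ^ 2 * c / branch r ε c i := by
    intro i
    have h1 := (Real.sqrt_pos.2 (hr i)).ne'
    have h2 := units_cast_sq (ε i)
    have h3 : ((ε i : ℤ) : ℝ) ≠ 0 := by exact_mod_cast Units.ne_zero _
    rw [branch]
    field_simp
    rw [h2, one_mul]
  have hss : √(1 - c ^ 2) ^ 2 = 1 - c ^ 2 := Real.sq_sqrt hs.le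
  have hs0 := (Real.sqrt_pos.2 hs).ne'
  rw [neg_mul, mul_neg, ← mul_assoc, mul_left_comm, ← hprod, jacobianDensity,
    Fin.sum_univ_succAbove _ l, Fin.prod_univ_succAbove _ l, prod_univ_erase_eq_prod_succAbove,
    hlast, branchDeriv]
  simp only [hex, hl, him, hre, hre', hterm]
  have hsum : ∑ i, r i ^ 2 * (1 - c ^ 2) * (c * (∏ i, branch r ε c i) / branch r ε c i) =
      (1 - c ^ 2) * (∏ i, branch r ε c i) * ∑ i, r i ^ 2 * c / branch r ε c i := by
    rw [Finset.mul_sum]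
    exact Finset.sum_congr rfl fun i _ => by ring
  rw [hsum]
  generalize ∑ i, r i ^ 2 * c / branch r ε c i = T
  generalize √(1 - c ^ 2) = s at *
  rw [← hss]
  field_simp
  ring

theorem sign_jacobianDensity_eq {e : ℕ} {m q c : ℝ} {r : Fin e → ℝ} {ε : Fin e → ℤˣ}
    (hc : c ∈ Set.Ioo (-1 : ℝ) 1) (hr : ∀ i, 0 < 1 - r i ^ 2 * (1 - c ^ 2))
    {z : Torus (e + 1)} {l : Fin (e + 1)} (hre : (z l : ℂ).re = c)
    (hre' : ∀ i, (z (l.succAbove i) : ℂ).re = branch r ε c i)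
    (him : ∀ i, (z (l.succAbove i) : ℂ).im ^ 2 = r i ^ 2 * (1 - c ^ 2))
    (hlast : lastCoord m z = q * √(1 - c ^ 2)) :
    (SignType.sign (jacobianDensity m z) : ℤ) =
      -((∏ i, ε i : ℤˣ) : ℤ) * (SignType.sign (branchDeriv q r ε c) : ℤ) := by
  have hpos : 0 < (1 - c ^ 2) * ∏ i, √(1 - r i ^ 2 * (1 - c ^ 2)) :=
    mul_pos (one_sub_sq_pos hc) (Finset.prod_pos fun i _ => Real.sqrt_pos.2 (hr i))
  rw [jacobianDensity_eq_branchDeriv hc hr hre hre' him hlast, sign_units_mul, neg_mul,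
    Left.sign_neg, sign_mul, sign_pos hpos, one_mul]
  simp

/-- Each product in the density omits at most one cosine, so two vanishing cosines kill every term.
-/
theorem jacobianDensity_eq_zero_of_re {d : ℕ} (m : ℝ) {z : Torus d} {k l : Fin d} (hkl : k ≠ l)
    (hk : (z k : ℂ).re = 0) (hl : (z l : ℂ).re = 0) : jacobianDensity m z = 0 := by
  rw [jacobianDensity, Finset.prod_eq_zero (Finset.mem_univ k) hk, mul_zero, sub_zero]
  refine Finset.sum_eq_zero fun n _ => ?_
  rcases eq_or_ne n k with rfl | h
  · rw [Finset.prod_eq_zero (Finset.mem_erase.2 ⟨hkl.symm, Finset.mem_univ l⟩) hl, mul_zero]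
  · rw [Finset.prod_eq_zero (Finset.mem_erase.2 ⟨h.symm, Finset.mem_univ k⟩) hk, mul_zero]

/-! ### The signed count of the preimages -/

/-- The signs of the cosines of all angles but the `l`-th one. -/
noncomputable def signVec {e : ℕ} (l : Fin (e + 1)) (z : Torus (e + 1)) (i : Fin e) : ℤˣ :=
  -- A zero cosine gets the value `-1`. `re_eq_signVec_mul_abs` still holds there, and over regular
  -- values the case is excluded by `radicand_pos_of_fMap_eq`.
  if 0 < (z (l.succAbove i) : ℂ).re then 1 else -1

theorem re_eq_signVec_mul_abs {e : ℕ} (l : Fin (e + 1)) (z : Torus (e + 1)) (i : Fin e) :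
    (z (l.succAbove i) : ℂ).re = ((signVec l z i : ℤ) : ℝ) * |(z (l.succAbove i) : ℂ).re| := by
  unfold signVec
  split_ifs with h
  · simp [abs_of_pos h]
  · simp [abs_of_nonpos (not_lt.1 h)]

section Preimage

variable {e : ℕ} {m : ℝ} {l : Fin (e + 1)} {p : Sphere (e + 1)}

/-- The coordinate `p_n` of a point of the sphere, for `n ≤ d`. -/
noncomputable def sphereCoord {d : ℕ} (p : Sphere d) (n : Fin d) : ℝ :=
  (p : EuclideanSpace ℝ (Fin (d + 1))) n.castSucc

/-- The last coordinate of a point of the sphere. -/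
noncomputable def sphereLast {d : ℕ} (p : Sphere d) : ℝ :=
  (p : EuclideanSpace ℝ (Fin (d + 1))) (Fin.last d)

/-- The ratios of the coordinates of `p` to the `l`-th one. -/
noncomputable def coordRatio (l : Fin (e + 1)) (p : Sphere (e + 1)) (i : Fin e) : ℝ :=
  sphereCoord p (l.succAbove i) / sphereCoord p l

/-- Maximality of `|p_l|` keeps the radicands in `branch` nonnegative on all of `[-1, 1]`, so the
square roots never take their default value. -/
theorem coordRatio_sq_le_one
    (hmax : ∀ n, |sphereCoord p n| ≤ |sphereCoord p l|) (i : Fin e) :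
    coordRatio l p i ^ 2 ≤ 1 := by
  rw [sq_le_one_iff_abs_le_one, coordRatio, abs_div]
  exact div_le_one_of_le₀ (hmax _) (abs_nonneg _)

/-- The ray parameter `t` is eliminated: `sin²θ_l = t² p_l²` gives `t = √(1 - c²) / |p_l|`. -/
theorem coords_of_fMap_eq (hm : ∀ k : ℕ, k ≤ e + 1 → m ≠ ((e + 1 : ℕ) : ℝ) - 2 * k)
    (hl : sphereCoord p l ≠ 0) {z : Torus (e + 1)} (hz : fMap (e + 1) m hm z = p) :
    (z l : ℂ).re ∈ Set.Ioo (-1 : ℝ) 1 ∧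
    (∀ n, (z n : ℂ).im = √(1 - (z l : ℂ).re ^ 2) / |sphereCoord p l| * sphereCoord p n) ∧
    lastCoord m z = sphereLast p / |sphereCoord p l| * √(1 - (z l : ℂ).re ^ 2) := by
  obtain ⟨t, ht, h1, h2⟩ := (fMap_eq_iff hm z p).1 hz
  have ha := abs_pos.2 hl
  have hsq : 1 - (z l : ℂ).re ^ 2 = (t * |sphereCoord p l|) ^ 2 := by
    rw [mul_pow, sq_abs, ← mul_pow, sphereCoord, ← h1]
    linarith [circle_re_sq_add_im_sq (z l)]
  have hs : √(1 - (z l : ℂ).re ^ 2) = t * |sphereCoord p l| := by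
    rw [hsq, Real.sqrt_sq (by positivity)]
  have hpos : 0 < (t * |sphereCoord p l|) ^ 2 := by positivity
  refine ⟨?_, fun n => ?_, ?_⟩
  · rw [Set.mem_Ioo, ← abs_lt, ← sq_lt_one_iff_abs_lt_one]
    linarith
  · rw [hs, mul_div_cancel_right₀ _ ha.ne', h1]; rfl
  · rw [hs, h2, sphereLast]
    field_simp

theorem im_sq_of_fMap_eq (hm : ∀ k : ℕ, k ≤ e + 1 → m ≠ ((e + 1 : ℕ) : ℝ) - 2 * k)
    (hl : sphereCoord p l ≠ 0) {z : Torus (e + 1)} (hz : fMap (e + 1) m hm z = p) (i : Fin e) :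
    (z (l.succAbove i) : ℂ).im ^ 2 = coordRatio l p i ^ 2 * (1 - (z l : ℂ).re ^ 2) := by
  obtain ⟨h1, h2, -⟩ := coords_of_fMap_eq hm hl hz
  have := (one_sub_sq_pos h1).le
  rw [h2, coordRatio, mul_pow, div_pow, div_pow, Real.sq_sqrt this, sq_abs]
  ring

theorem re_eq_branch_of_fMap_eq (hm : ∀ k : ℕ, k ≤ e + 1 → m ≠ ((e + 1 : ℕ) : ℝ) - 2 * k)
    (hl : sphereCoord p l ≠ 0) {z : Torus (e + 1)} (hz : fMap (e + 1) m hm z = p) (i : Fin e) :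
    (z (l.succAbove i) : ℂ).re = branch (coordRatio l p) (signVec l z) (z l : ℂ).re i := by
  rw [branch, ← im_sq_of_fMap_eq hm hl hz i, re_eq_signVec_mul_abs, ← Real.sqrt_sq_eq_abs]
  congr 2
  linarith [circle_re_sq_add_im_sq (z (l.succAbove i))]

theorem branchFun_eq_zero_of_fMap_eq (hm : ∀ k : ℕ, k ≤ e + 1 → m ≠ ((e + 1 : ℕ) : ℝ) - 2 * k)
    (hl : sphereCoord p l ≠ 0) {z : Torus (e + 1)} (hz : fMap (e + 1) m hm z = p) :
    branchFun m (sphereLast p / |sphereCoord p l|) (coordRatio l p) (signVec l z)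
      (z l : ℂ).re = 0 := by
  obtain ⟨-, -, h3⟩ := coords_of_fMap_eq hm hl hz
  rw [branchFun, ← h3, lastCoord, Fin.sum_univ_succAbove _ l]
  simp only [← re_eq_branch_of_fMap_eq hm hl hz]
  ring

/-- A vanishing radicand together with `r_i² ≤ 1` forces `c = 0`; then the `l`-th cosine and the one
belonging to `i` both vanish, and so does the density. -/
theorem radicand_pos_of_fMap_eq (hm : ∀ k : ℕ, k ≤ e + 1 → m ≠ ((e + 1 : ℕ) : ℝ) - 2 * k)
    (hl : sphereCoord p l ≠ 0) (hmax : ∀ n, |sphereCoord p n| ≤ |sphereCoord p l|)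
    {z : Torus (e + 1)} (hz : fMap (e + 1) m hm z = p) (hE : jacobianDensity m z ≠ 0)
    (i : Fin e) : 0 < 1 - coordRatio l p i ^ 2 * (1 - (z l : ℂ).re ^ 2) := by
  obtain ⟨h1, -, -⟩ := coords_of_fMap_eq hm hl hz
  have hr := coordRatio_sq_le_one hmax i
  refine lt_of_le_of_ne (radicand_nonneg hr (one_sub_sq_pos h1).le) fun h => hE ?_
  refine jacobianDensity_eq_zero_of_re m (l.succAbove_ne i) ?_ ?_
  · have h2 := im_sq_of_fMap_eq hm hl hz i
    have h3 := circle_re_sq_add_im_sq (z (l.succAbove i))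
    exact pow_eq_zero_iff two_ne_zero |>.1 (by linarith)
  · have h2 := mul_le_mul_of_nonneg_right hr (one_sub_sq_pos h1).le
    exact pow_eq_zero_iff two_ne_zero |>.1 (le_antisymm (by linarith) (sq_nonneg _))

theorem exists_fMap_eq_of_branchFun_eq_zero
    (hm : ∀ k : ℕ, k ≤ e + 1 → m ≠ ((e + 1 : ℕ) : ℝ) - 2 * k)
    (hl : sphereCoord p l ≠ 0) (hmax : ∀ n, |sphereCoord p n| ≤ |sphereCoord p l|)
    {ε : Fin e → ℤˣ} {c : ℝ} (hc : c ∈ Set.Ioo (-1 : ℝ) 1)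
    (h0 : branchFun m (sphereLast p / |sphereCoord p l|) (coordRatio l p) ε c = 0) :
    ∃ z, fMap (e + 1) m hm z = p ∧ (z l : ℂ).re = c ∧
      ∀ i, (z (l.succAbove i) : ℂ).re = branch (coordRatio l p) ε c i := by
  have hs := one_sub_sq_pos hc
  have ha := abs_pos.2 hl
  -- The cosines are those of the branch, the sines the multiple of `p` dictated by
  -- `coords_of_fMap_eq`; `branchFun = 0` is then the equation for the last coordinate.
  have hcirc : ∀ n, (Fin.insertNth l c (branch (coordRatio l p) ε c) : Fin (e + 1) → ℝ) n ^ 2 +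
      (√(1 - c ^ 2) / |sphereCoord p l| * sphereCoord p n) ^ 2 = 1 := by
    rw [Fin.forall_iff_succAbove l]
    constructor
    · rw [Fin.insertNth_apply_same, mul_pow, div_pow, Real.sq_sqrt hs.le, sq_abs]
      field_simp
      ring
    · intro i
      rw [Fin.insertNth_apply_succAbove, mul_pow, div_pow, Real.sq_sqrt hs.le, sq_abs, branch,
        mul_pow, units_cast_sq, one_mul,
        Real.sq_sqrt (radicand_nonneg (coordRatio_sq_le_one hmax i) hs.le), coordRatio]
      field_simp
      ring
  refine ⟨fun n => circleMk _ _ (hcirc n), ?_, ?_, fun i => ?_⟩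
  · rw [fMap_eq_iff]
    refine ⟨√(1 - c ^ 2) / |sphereCoord p l|, by positivity, fun n => rfl, ?_⟩
    rw [lastCoord, Fin.sum_univ_succAbove _ l]
    simp only [circleMk_re, Fin.insertNth_apply_same, Fin.insertNth_apply_succAbove]
    rw [branchFun, sphereLast] at h0
    linear_combination h0
  · simp only [circleMk_re, Fin.insertNth_apply_same]
  · simp only [circleMk_re, Fin.insertNth_apply_succAbove]

theorem signVec_eq_of_re_eq_branch {r : Fin e → ℝ} {ε : Fin e → ℤˣ} {c : ℝ} {z : Torus (e + 1)}
    (hr : ∀ i, 0 < 1 - r i ^ 2 * (1 - c ^ 2))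
    (hz : ∀ i, (z (l.succAbove i) : ℂ).re = branch r ε c i) : signVec l z = ε := by
  funext i
  have := Real.sqrt_pos.2 (hr i)
  rw [signVec, hz, branch]
  rcases Int.units_eq_one_or (ε i) with h | h
  · simp [h, this]
  · simp [h, this.le]

theorem eq_of_fMap_eq (hm : ∀ k : ℕ, k ≤ e + 1 → m ≠ ((e + 1 : ℕ) : ℝ) - 2 * k)
    (hl : sphereCoord p l ≠ 0) {z w : Torus (e + 1)} (hz : fMap (e + 1) m hm z = p)
    (hw : fMap (e + 1) m hm w = p) (h : (z l : ℂ).re = (w l : ℂ).re)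
    (hs : signVec l z = signVec l w) : z = w := by
  have him : ∀ n, (z n : ℂ).im = (w n : ℂ).im := fun n => by
    rw [(coords_of_fMap_eq hm hl hz).2.1, (coords_of_fMap_eq hm hl hw).2.1, h]
  have hre : ∀ n, (z n : ℂ).re = (w n : ℂ).re := by
    rw [Fin.forall_iff_succAbove l]
    refine ⟨h, fun i => ?_⟩
    rw [re_eq_branch_of_fMap_eq hm hl hz, re_eq_branch_of_fMap_eq hm hl hw, h, hs]
  funext n
  exact Circle.ext (Complex.ext (hre n) (him n))

/-- The preimage is split according to `signVec`. On each part `z ↦ cos θ_l` is a bijection onto the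
zeros of one `branchFun`, to which `two_mul_sum_sign_deriv` applies, and `signSum_succ` assembles
the end signs. -/
theorem sum_sign_jacobianDensity_of_coord_ne_zero
    (hm : ∀ k : ℕ, k ≤ e + 1 → m ≠ ((e + 1 : ℕ) : ℝ) - 2 * k)
    (hl : sphereCoord p l ≠ 0) (hmax : ∀ n, |sphereCoord p n| ≤ |sphereCoord p l|)
    (hE : ∀ z, fMap (e + 1) m hm z = p → jacobianDensity m z ≠ 0) :
    ∃ hfin : (fMap (e + 1) m hm ⁻¹' {p}).Finite,
      2 * ∑ z ∈ hfin.toFinset, (SignType.sign (jacobianDensity m z) : ℤ) = -signSum (e + 1) m := by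
  set q := sphereLast p / |sphereCoord p l|
  set r := coordRatio l p
  have hroot : ∀ ε : Fin e → ℤˣ, ∀ c ∈ Set.Ioo (-1 : ℝ) 1, branchFun m q r ε c = 0 →
      ∃ z, fMap (e + 1) m hm z = p ∧ (z l : ℂ).re = c ∧ signVec l z = ε := by
    intro ε c hc h0
    obtain ⟨z, hz, h1, h2⟩ := exists_fMap_eq_of_branchFun_eq_zero hm hl hmax hc h0
    have h3 := radicand_pos_of_fMap_eq hm hl hmax hz (hE z hz)
    rw [h1] at h3
    exact ⟨z, hz, h1, signVec_eq_of_re_eq_branch h3 h2⟩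
  have hsign : ∀ z, fMap (e + 1) m hm z = p → (SignType.sign (jacobianDensity m z) : ℤ) =
      -((∏ i, signVec l z i : ℤˣ) : ℤ) *
        (SignType.sign (branchDeriv q r (signVec l z) (z l : ℂ).re) : ℤ) := fun z hz =>
    sign_jacobianDensity_eq (coords_of_fMap_eq hm hl hz).1
      (radicand_pos_of_fMap_eq hm hl hmax hz (hE z hz)) rfl
      (re_eq_branch_of_fMap_eq hm hl hz) (im_sq_of_fMap_eq hm hl hz) (coords_of_fMap_eq hm hl hz).2.2
  have hderiv : ∀ ε : Fin e → ℤˣ, ∀ c ∈ Set.Ioo (-1 : ℝ) 1, branchFun m q r ε c = 0 →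
      HasDerivAt (branchFun m q r ε) (branchDeriv q r ε c) c ∧ branchDeriv q r ε c ≠ 0 := by
    intro ε c hc h0
    -- Every zero comes from a preimage of `p`, so a nonvanishing density there makes the zero
    -- simple.
    obtain ⟨z, hz, rfl, rfl⟩ := hroot ε c hc h0
    refine ⟨hasDerivAt_branchFun m q _ hc fun i =>
      (radicand_pos_of_fMap_eq hm hl hmax hz (hE z hz) i).ne', fun h => ?_⟩
    have h1 := hsign z hz
    rw [h, sign_zero, SignType.coe_zero, mul_zero] at h1
    rcases lt_or_gt_of_ne (hE z hz) with h2 | h2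
    · simp [sign_neg h2] at h1
    · simp [sign_pos h2] at h1
  have hends : ∀ ε : Fin e → ℤˣ, branchFun m q r ε 1 ≠ 0 ∧ branchFun m q r ε (-1) ≠ 0 := by
    intro ε
    -- An end value is `m` minus a full sum of `d` signs, with `u` as the `l`-th one; the excluded
    -- values of `m` are exactly such sums.
    have h1 := fun u : ℤˣ => sub_sum_units_ne_zero hm (Fin.insertNth l u ε)
    simp only [Fin.sum_univ_succAbove _ l, Fin.insertNth_apply_same,
      Fin.insertNth_apply_succAbove] at h1
    constructor
    · rw [branchFun_of_sq_eq_one m q r ε (by norm_num), sub_sub]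
      simpa using h1 1
    · rw [branchFun_of_sq_eq_one m q r ε (by norm_num), sub_sub]
      simpa using h1 (-1)
  have hzeros := fun ε : Fin e → ℤˣ => finite_setOf_simple_zero
    (continuous_branchFun m q r ε).continuousOn (hends ε).2 (hends ε).1 (hderiv ε)
  have hfin : (fMap (e + 1) m hm ⁻¹' {p}).Finite := by
    refine Set.Finite.subset (Set.finite_iUnion fun ε : Fin e → ℤˣ => ?_ :
      (⋃ ε : Fin e → ℤˣ, {z | fMap (e + 1) m hm z = p ∧ signVec l z = ε}).Finite) ?_
    · refine Set.Finite.of_finite_image (f := fun z : Torus (e + 1) => (z l : ℂ).re)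
        ((hzeros ε).subset ?_) ?_
      · rintro _ ⟨z, ⟨hz, rfl⟩, rfl⟩
        exact ⟨(coords_of_fMap_eq hm hl hz).1, branchFun_eq_zero_of_fMap_eq hm hl hz⟩
      · rintro z ⟨hz, hz'⟩ w ⟨hw, hw'⟩ h
        exact eq_of_fMap_eq hm hl hz hw h (hz'.trans hw'.symm)
    · intro z hz
      exact Set.mem_iUnion.2 ⟨signVec l z, hz, rfl⟩
  have hmem : ∀ z, z ∈ hfin.toFinset ↔ fMap (e + 1) m hm z = p := fun z => by simp
  refine ⟨hfin, ?_⟩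
  rw [← Finset.sum_fiberwise hfin.toFinset (signVec l), Finset.mul_sum, signSum_succ l,
    ← Finset.sum_neg_distrib]
  refine Finset.sum_congr rfl fun ε _ => ?_
  have hcount := two_mul_sum_sign_deriv (by norm_num : (-1 : ℝ) < 1)
    (continuous_branchFun m q r ε).continuousOn (hends ε).2 (hends ε).1 (hderiv ε)
    (Z := (hzeros ε).toFinset) (fun t => by simp)
  rw [branchFun_of_sq_eq_one m q r ε (by norm_num), branchFun_of_sq_eq_one m q r ε (by norm_num),
    sub_neg_eq_add] at hcount
  rw [← hcount, mul_left_comm, ← mul_neg, ← neg_mul]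
  congr 1
  rw [Finset.mul_sum]
  refine Finset.sum_bij (fun (z : Torus (e + 1)) _ => (z l : ℂ).re) ?_ ?_ ?_ ?_
  · intro z hz
    obtain ⟨h1, rfl⟩ := Finset.mem_filter.1 hz
    rw [hmem] at h1
    rw [Set.Finite.mem_toFinset]
    exact ⟨(coords_of_fMap_eq hm hl h1).1, branchFun_eq_zero_of_fMap_eq hm hl h1⟩
  · intro z hz w hw h
    obtain ⟨h1, h2⟩ := Finset.mem_filter.1 hz
    obtain ⟨h3, h4⟩ := Finset.mem_filter.1 hw
    exact eq_of_fMap_eq hm hl ((hmem z).1 h1) ((hmem w).1 h3) h (h2.trans h4.symm)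
  · intro c hc
    obtain ⟨h1, h2⟩ := (Set.Finite.mem_toFinset _).1 hc
    obtain ⟨z, hz, h3, h4⟩ := hroot ε c h1 h2
    exact ⟨z, Finset.mem_filter.2 ⟨(hmem z).2 hz, h4⟩, h3⟩
  · intro z hz
    obtain ⟨h1, rfl⟩ := Finset.mem_filter.1 hz
    exact hsign z ((hmem z).1 h1)

end Preimage

theorem sum_sign_jacobianDensity {d : ℕ} (hd : 0 < d) {m : ℝ}
    (hm : ∀ k : ℕ, k ≤ d → m ≠ (d : ℝ) - 2 * k) {p : Sphere d}
    (hE : ∀ z, fMap d m hm z = p → jacobianDensity m z ≠ 0) :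
    ∃ hfin : (fMap d m hm ⁻¹' {p}).Finite,
      2 * ∑ z ∈ hfin.toFinset, (SignType.sign (jacobianDensity m z) : ℤ) = -signSum d m := by
  obtain ⟨e, rfl⟩ := Nat.exists_eq_succ_of_ne_zero hd.ne'
  by_cases hp : ∀ n, sphereCoord p n = 0
  · exact sum_sign_jacobianDensity_of_pole hd hm hp
  · obtain ⟨l, -, hmax⟩ := Finset.exists_max_image Finset.univ (fun n => |sphereCoord p n|)
      Finset.univ_nonempty
    refine sum_sign_jacobianDensity_of_coord_ne_zero (l := l) hm (fun h => hp fun n => ?_)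
      (fun n => hmax n (Finset.mem_univ n)) hE
    have := hmax n (Finset.mem_univ n)
    rw [h, abs_zero] at this
    exact abs_nonpos_iff.1 this

theorem isRegularValue_fMap_iff {d : ℕ} (hd : Even d) (hd0 : 0 < d) {m : ℝ}
    (hm : ∀ k : ℕ, k ≤ d → m ≠ (d : ℝ) - 2 * k) (p : Sphere d) :
    IsRegularValue (fMap d m hm) p ↔ ∀ z, fMap d m hm z = p → jacobianDensity m z ≠ 0 := by
  constructor
  · rintro h z rfl h0
    obtain ⟨j, hj⟩ := exists_mem_torusDomain z
    obtain ⟨i, hi⟩ := exists_mem_sphereDomain (fMap d m hm z)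
    obtain ⟨c, -, hc⟩ := exists_jacobianDet_eq hd hd0 hm j i hj hi
    exact h z rfl j i hj hi (by rw [hc, h0, mul_zero])
  · rintro h z rfl j i hj hi
    obtain ⟨c, hc0, hc⟩ := exists_jacobianDet_eq hd hd0 hm j i hj hi
    rw [hc]
    exact mul_ne_zero hc0.ne' (h z rfl)

theorem exists_pole {d : ℕ} : ∃ p : Sphere d, ∀ n, sphereCoord p n = 0 := by
  refine ⟨⟨EuclideanSpace.single (Fin.last d) 1, by simp⟩, fun n => ?_⟩
  simp [sphereCoord]

theorem hasMappingDegree_fMap {d : ℕ} (hd : Even d) (hd0 : 0 < d) {m : ℝ}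
    (hm : ∀ k : ℕ, k ≤ d → m ≠ (d : ℝ) - 2 * k) {N : ℤ} (hN : -signSum d m = 2 * N) :
    HasMappingDegree (fMap d m hm) N where
  smooth := isSmoothMap_fMap (by obtain ⟨e, rfl⟩ := hd; omega) hm
  exists_regularValue := by
    obtain ⟨p, hp⟩ := exists_pole (d := d)
    exact ⟨p, (isRegularValue_fMap_iff hd hd0 hm p).2 fun z hz =>
      jacobianDensity_ne_zero_of_pole hm hp hz⟩
  degree_eq p hp := by
    rw [isRegularValue_fMap_iff hd hd0 hm] at hp
    obtain ⟨hfin, hsum⟩ := sum_sign_jacobianDensity hd0 hm hp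
    refine ⟨hfin, fun z => SignType.sign (jacobianDensity m z), ?_, by linarith⟩
    rintro z rfl j i hj hi
    obtain ⟨c, hc0, hc⟩ := exists_jacobianDet_eq hd hd0 hm j i hj hi
    rw [hc, sign_mul, sign_pos hc0, one_mul]

end TorusSphere

theorem mainTheorem12 (d : ℕ) (hd : Even d) (hd0 : 0 < d) (m : ℝ)
    (hm : ∀ k : ℕ, k ≤ d → m ≠ (d : ℝ) - 2 * k) :
    (∀ n : ℕ, Odd n → n < d + 1 → m ∈ Set.Ioo ((n : ℝ) - 1) ((n : ℝ) + 1) →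
      TorusSphere.HasMappingDegree (TorusSphere.fMap d m hm)
        (∑ k ∈ Finset.range ((d - n - 1) / 2 + 1), (-1 : ℤ) ^ k * (d.choose k : ℤ))) ∧
    (∀ n : ℕ, Odd n → n < d + 1 → m ∈ Set.Ioo (-(n : ℝ) - 1) (-(n : ℝ) + 1) →
      TorusSphere.HasMappingDegree (TorusSphere.fMap d m hm)
        (∑ k ∈ Finset.range ((d - n - 1) / 2 + 1), (-1 : ℤ) ^ (k + 1) * (d.choose k : ℤ))) ∧
    ((d : ℝ) < |m| → TorusSphere.HasMappingDegree (TorusSphere.fMap d m hm) 0) ∧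
    (m = (d : ℝ) - 1 → TorusSphere.HasMappingDegree (TorusSphere.fMap d m hm) 1) := by
  refine ⟨fun n hn hnd hmn => ?_, fun n hn hnd hmn => ?_, fun hmd => ?_, fun hmd => ?_⟩ <;>
    refine TorusSphere.hasMappingDegree_fMap hd hd0 hm ?_
  · exact TorusSphere.signSum_eq_of_mem_Ioo hd hn hnd hmn
  -- Negative `m` reduces to `-m`, as `signSum` is odd in `m`.
  · have h := TorusSphere.signSum_eq_of_mem_Ioo hd hn hnd (m := -m)
      ⟨by linarith [hmn.2], by linarith [hmn.1]⟩
    rw [TorusSphere.signSum_neg hd, neg_neg] at h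
    simp only [pow_succ, mul_neg_one, neg_mul, Finset.sum_neg_distrib]
    linarith
  · rw [TorusSphere.signSum_eq_zero hd hd0 hmd]
    norm_num
  -- For `n = d - 1` the interval is `(d - 2, d)`, and only the term `k = 0` remains.
  · have h := TorusSphere.signSum_eq_of_mem_Ioo hd (n := d - 1) (Nat.Even.sub_odd hd0 hd odd_one)
      (by omega) (m := m) (by
        rw [Nat.cast_sub hd0, hmd]
        constructor <;> push_cast <;> linarith)
    rw [h, show (d - (d - 1) - 1) / 2 + 1 = 1 by omega]
    simp
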